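/- **Conventions.** A ranked alphabet is a finite set of symbols, each with a fixed rank in $\mathbb N$. $T_\Sigma(X)$ is the set of terms over the ranked alphabet $\Sigma$ and the variables $X=\{x_1,x_2,\dots\}$, and $T_\Sigma$ the set of ground (variable-free) terms. $POS(t)$ is the set of positions of $t$, $\lambda$ is the root position, $t/\alpha$ is the subterm of $t$ at $\alpha$, $var(t)$ is the set of variables of $t$, and $sub(t)$, $sub(L)$ are the sets of subterms of $t$ and of the elements of $L$. A term is linear if no variable occurs in it more than once; $u$ is a supertree of $v$ if $u$ is linear and $v=\sigma(u)$ for some substitution $\sigma$. A term rewrite system (TRS) $R$ is a finite set of rules $l\to r$ between terms with $var(r)\subseteq var(l)$; $sign(R)$ is the set of symbols occurring in its rules; $R$ is left-linear if every left-hand side is linear; $\to_R^*$ is the reflexive transitive closure of one-step rewriting, and $R^*(L)=\{p\mid q\to_R^* p\text{ for some }q\in L\}$. Call $(l_2,\beta,l_3,\sigma)$ an *overlap* of $R$ if there are rules $l_1\to r_1$, $l_2\to r_2$ in $R$ and a position $\alpha\in POS(r_1)$ such that $\beta\in POS(l_2)$, $\alpha=\lambda$ or $\beta=\lambda$, $l_3$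 is a supertree of $l_2/\beta$ with $var(l_3)\cap var(l_1)=\emptyset$, and $\sigma$ is a most general unifier of $r_1/\alpha$ and $l_3$. $R$ is a *generalized semi-monadic* TRS (GSM-TRS) if no left-hand side is a variable and, for every overlap $(l_2,\beta,l_3,\sigma)$, either $l_2/\beta$ is a variable, or for each $\gamma\in POS(l_3)$ such that $l_2/\beta\gamma$ is a variable, $\sigma(l_3/\gamma)$ is a variable or a ground term. A bottom-up tree automaton (bta) over $\Sigma$ consists of a finite set of states (new symbols of rank $0$), a subset of final states, and a finite set of rules of the forms $\delta(a_1,\dots,a_n)\to a$ with $\delta\in\Sigma$ of rank $n$, and $a\to a'$, where $a_1,\dots,a_n,a,a'$ are states. Its rules form a ground TRS, and it recognizes the set of all $t\in T_\Sigma$ that reduce to a final state. $R$ is an *EPRF-TRS* (it effectively preserves recognizability of finite tree languages) if there is an algorithm that, given a ranked alphabet $\Sigma\supseteq sign(R)$ and a finite $L\subseteq T_\Sigma$, computes a bta over $\Sigma$ that recognizes $R^*(L)$. **Theorem.** Let $R$ be a left-linear GSM-TRS. Then $R$ is an EPRF-TRS. Moreover, an automaton for $R^*(L)$ is given by the following construction.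 Let $E$ be the set of all ground terms of the form $\sigma(l_3/\gamma)$, where $(l_2,\beta,l_3,\sigma)$ is an overlap of $R$, $l_3$ is not a variable, $\gamma\in POS(l_3)$ and $l_2/\beta\gamma$ is a variable. Let $\Sigma\supseteq sign(R)$ be a ranked alphabet and $L\subseteq T_\Sigma$ finite. Let $D$ be the union of $sub(L)$ and the set of all $e(p)$, where $p$ is a subterm of the right-hand side of a rule of $R$ and $e$ is a substitution with $e(x)\in sub(L\cup E)$ for all $x\in var(p)$. For $i\ge 0$ let $\mathcal C_i$ have the states $\langle p\rangle$, $p\in sub(D)$, the final states $\langle p\rangle$, $p\in L$, and the rule set $S_i$, where - $S_0$ consists of all rules $\delta(\langle p_1\rangle,\dots,\langle p_m\rangle)\to\langle\delta(p_1,\dots,p_m)\rangle$ with $\delta\in\Sigma$ of rank $m$ and $p_1,\dots,p_m,\delta(p_1,\dots,p_m)\in sub(D)$ (the rules of the fundamental automaton of $D$); - $S_{i+1}$ consists of $S_i$ and of all rules $\langle e(r)\rangle\to c$ such that $l\to r$ is a rule of $R$, $e$ is a substitution with $e(x)\in sub(L\cup E)$ for all $x\in var(l)$, $c$ is a state, and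 the term obtained from $l$ by replacing each variable $x$ by the state $\langle e(x)\rangle$ reduces to $c$ by $S_i$. Then $E$ and $D$ are finite, there is a least $M\ge 0$ with $S_M=S_{M+1}$, and $\mathcal C_M$ is a bta over $\Sigma$ that recognizes $R^*(L)$. -/

import Mathlib

/-! ## Terms

`F` is a type of symbols and `ar : F → ℕ` gives every symbol its (unique) rank.  A ranked alphabet is
a finite set of symbols.  Variables are natural numbers. -/

/-- Well-ranked terms with variables `var 0, var 1, …`. -/
inductive Term {F : Type} (ar : F → ℕ) : Type
  | var (x : ℕ) : Term ar
  | app (f : F) (ts : Fin (ar f) → Term ar) : Term ar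

namespace Term

variable {F : Type} {ar : F → ℕ}

/-- Application of a substitution. -/
def subst (σ : ℕ → Term ar) : Term ar → Term ar
  | var x => σ x
  | app f ts => app f (fun i => subst σ (ts i))

/-- The subterm `t/α` at the position `α`; it is `none` if `α` is not a position of `t`.
The arguments of a symbol are numbered from `0`. -/
def subAt : Term ar → List ℕ → Option (Term ar)
  | var x, [] => some (var x)
  | var _, _ :: _ => none
  | app f ts, [] => some (app f ts)
  | app f ts, i :: α => if h : i < ar f then subAt (ts ⟨i, h⟩) α else none

/-- The set of subterms. -/
def sub (t : Term ar) : Set (Term ar) := {s | ∃ α, t.subAt α = some s}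

/-- The set of variables occurring in a term. -/
def vars (t : Term ar) : Set ℕ := {x | var x ∈ t.sub}

/-- The set of symbols occurring in a term. -/
def symbols (t : Term ar) : Set F := {f | ∃ ts, app f ts ∈ t.sub}

def IsVar (t : Term ar) : Prop := ∃ x, t = var x

def IsGround (t : Term ar) : Prop := t.vars = ∅

/-- Every variable occurs at most once. -/
def Linear (t : Term ar) : Prop :=
  ∀ x α β, t.subAt α = some (var x) → t.subAt β = some (var x) → α = β

/-- `u` is a supertree of `v`: it is linear, and `v` is an instance of it. -/
def Supertree (u v : Term ar) : Prop := u.Linear ∧ ∃ σ : ℕ → Term ar, v = u.subst σ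

/-- `σ` is a most general unifier of `s` and `t`. -/
def IsMGU (σ : ℕ → Term ar) (s t : Term ar) : Prop :=
  s.subst σ = t.subst σ ∧
    ∀ θ : ℕ → Term ar, s.subst θ = t.subst θ → ∃ τ : ℕ → Term ar, ∀ x, θ x = (σ x).subst τ

/-- The word of symbols of a ground term in prefix (Polish) notation. -/
def word : Term ar → List F
  | var _ => []
  | app f ts => f :: (List.ofFn fun i => word (ts i)).flatten

end Term

/-- The set `T_Σ` of ground terms over the alphabet `Sg`. -/
def groundTerms {F : Type} (ar : F → ℕ) (Sg : Set F) : Set (Term ar) :=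
  {t | t.IsGround ∧ t.symbols ⊆ Sg}

/-- The set `sub(L)` of subterms of the elements of a tree language. -/
def subLang {F : Type} {ar : F → ℕ} (L : Set (Term ar)) : Set (Term ar) := ⋃ t ∈ L, t.sub

/-! ## Term rewrite systems -/

/-- One rewrite step: an instance of a left-hand side, at some position, is replaced by the
corresponding instance of the right-hand side. -/
inductive Step {F : Type} {ar : F → ℕ} (R : Set (Term ar × Term ar)) : Term ar → Term ar → Prop
  | root (l r : Term ar) (σ : ℕ → Term ar) (h : (l, r) ∈ R) : Step R (l.subst σ) (r.subst σ)
  | arg (f : F) (ts : Fin (ar f) → Term ar) (i : Fin (ar f)) (s : Term ar) (h : Step R (ts i) s) :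
      Step R (Term.app f ts) (Term.app f (Function.update ts i s))

/-- Reduction in any finite number of steps. -/
def Reduces {F : Type} {ar : F → ℕ} (R : Set (Term ar × Term ar)) : Term ar → Term ar → Prop :=
  Relation.ReflTransGen (Step R)

/-- A term rewrite system: finitely many rules `l → r`, each variable of `r` occurring in `l`. -/
structure TRS {F : Type} (ar : F → ℕ) where
  rules : Set (Term ar × Term ar)
  finite : rules.Finite
  vars_subset : ∀ l r, (l, r) ∈ rules → r.vars ⊆ l.vars

namespace TRS

variable {F : Type} {ar : F → ℕ}

/-- `sign(R)`: the symbols appearing in the rules. -/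
def sign (R : TRS ar) : Set F := {f | ∃ l r, (l, r) ∈ R.rules ∧ (f ∈ l.symbols ∨ f ∈ r.symbols)}

def LeftLinear (R : TRS ar) : Prop := ∀ l r, (l, r) ∈ R.rules → l.Linear

/-- `R*(L)`: the set of descendants of the trees in `L`. -/
def descendants (R : TRS ar) (L : Set (Term ar)) : Set (Term ar) :=
  {p | ∃ q ∈ L, Reduces R.rules q p}

/-- There are rules `l₁ → r₁` and `l₂ → r₂` and positions `α` of `r₁` and `β` of `l₂`, one of them
the root, such that `l₃` is a supertree of `l₂/β`, has no variable in common with `l₁`, and has the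
most general unifier `σ` with `r₁/α`. -/
def Overlap (R : TRS ar) (l₂ : Term ar) (β : List ℕ) (l₃ : Term ar) (σ : ℕ → Term ar) : Prop :=
  ∃ l₁ r₁ r₂ : Term ar, (l₁, r₁) ∈ R.rules ∧ (l₂, r₂) ∈ R.rules ∧
    ∃ (α : List ℕ) (u v : Term ar), r₁.subAt α = some u ∧ l₂.subAt β = some v ∧
      (α = [] ∨ β = []) ∧ l₃.Supertree v ∧ Disjoint l₃.vars l₁.vars ∧ Term.IsMGU σ u l₃

/-- Generalized semi-monadic term rewrite systems. -/
def IsGSM (R : TRS ar) : Prop :=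
  (∀ l r, (l, r) ∈ R.rules → ¬ l.IsVar) ∧
    ∀ l₂ β l₃ σ, R.Overlap l₂ β l₃ σ →
      (∃ x, l₂.subAt β = some (Term.var x)) ∨
        ∀ γ w, l₃.subAt γ = some w → (∃ x, l₂.subAt (β ++ γ) = some (Term.var x)) →
          (w.subst σ).IsVar ∨ (w.subst σ).IsGround

/-- The set `E` of the ground terms `σ(l₃/γ)` that arise from overlaps with `l₃` not a variable. -/
def setE (R : TRS ar) : Set (Term ar) :=
  {u | u.IsGround ∧ ∃ l₂ β l₃ σ, R.Overlap l₂ β l₃ σ ∧ ¬ l₃.IsVar ∧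
    ∃ γ w, l₃.subAt γ = some w ∧ (∃ x, l₂.subAt (β ++ γ) = some (Term.var x)) ∧ u = w.subst σ}

/-- The set `D`: the subterms of `L`, and the subterms of right-hand sides with elements of
`sub(L ∪ E)` substituted for their variables. -/
def setD (R : TRS ar) (L : Set (Term ar)) : Set (Term ar) :=
  subLang L ∪
    {t | ∃ (l r p : Term ar) (e : ℕ → Term ar), (l, r) ∈ R.rules ∧ p ∈ r.sub ∧
      (∀ x ∈ p.vars, e x ∈ subLang (L ∪ R.setE)) ∧ t = p.subst e}

end TRS

/-! ## Bottom-up tree automata -/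

/-- The ranks of the symbols of the disjoint union of `F` with a set of states of rank `0`. -/
def stateRank {F : Type} (ar : F → ℕ) (Q : Type) : F ⊕ Q → ℕ := Sum.elim ar (fun _ => 0)

/-- A state, as a term. -/
def stateTerm {F : Type} (ar : F → ℕ) {Q : Type} (q : Q) : Term (stateRank ar Q) :=
  Term.app (ar := stateRank ar Q) (Sum.inr q) Fin.elim0

/-- A term over `F`, seen as a term over `F` and the states. -/
def Term.lift {F : Type} {ar : F → ℕ} (Q : Type) : Term ar → Term (stateRank ar Q)
  | .var x => .var x
  | .app f ts => Term.app (ar := stateRank ar Q) (Sum.inl f) (fun i => Term.lift Q (ts i))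

/-- The rule `δ(a₁, …, aₙ) → a`. -/
def symbolRule {F : Type} (ar : F → ℕ) {Q : Type} (δ : F) (as : Fin (ar δ) → Q) (a : Q) :
    Term (stateRank ar Q) × Term (stateRank ar Q) :=
  (Term.app (ar := stateRank ar Q) (Sum.inl δ) (fun i => stateTerm ar (as i)), stateTerm ar a)

/-- The rule `a → a'`. -/
def lambdaRule {F : Type} (ar : F → ℕ) {Q : Type} (a a' : Q) :
    Term (stateRank ar Q) × Term (stateRank ar Q) :=
  (stateTerm ar a, stateTerm ar a')

/-- The data of a tree automaton; see `IsBTA` for the conditions on them. -/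
structure TreeAutomaton {F : Type} (ar : F → ℕ) (Q : Type) where
  states : Set Q
  rules : Set (Term (stateRank ar Q) × Term (stateRank ar Q))
  final : Set Q

namespace TreeAutomaton

variable {F : Type} {ar : F → ℕ} {Q : Type}

/-- `A` is a bottom-up tree automaton over the alphabet `Sg`. -/
def IsBTA (Sg : Set F) (A : TreeAutomaton ar Q) : Prop :=
  A.states.Finite ∧ A.rules.Finite ∧ A.final ⊆ A.states ∧
    ∀ ρ ∈ A.rules,
      (∃ δ ∈ Sg, ∃ (as : Fin (ar δ) → Q) (a : Q),
        (∀ i, as i ∈ A.states) ∧ a ∈ A.states ∧ ρ = symbolRule ar δ as a) ∨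
      (∃ a ∈ A.states, ∃ a' ∈ A.states, ρ = lambdaRule ar a a')

/-- The tree language over `Sg` recognized by `A`, whose rules act as a ground rewrite system. -/
def language (Sg : Set F) (A : TreeAutomaton ar Q) : Set (Term ar) :=
  {t | t ∈ groundTerms ar Sg ∧ ∃ a ∈ A.final, Reduces A.rules (t.lift Q) (stateTerm ar a)}

/-- The fundamental automaton of a tree language over `Sg`; its states are the subterms of the
elements of the language. -/
def fundamental (Sg : Set F) (L : Set (Term ar)) : TreeAutomaton ar (Term ar) where
  states := subLang L
  rules := {ρ | ∃ δ ∈ Sg, ∃ ps : Fin (ar δ) → Term ar,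
    (∀ i, ps i ∈ subLang L) ∧ Term.app δ ps ∈ subLang L ∧ ρ = symbolRule ar δ ps (Term.app δ ps)}
  final := L

end TreeAutomaton

namespace TRS

variable {F : Type} {ar : F → ℕ}

/-- The rule sets `S₀ ⊆ S₁ ⊆ …` of the saturation procedure. -/
def satRules (R : TRS ar) (Sg : Set F) (L : Set (Term ar)) :
    ℕ → Set (Term (stateRank ar (Term ar)) × Term (stateRank ar (Term ar)))
  | 0 => (TreeAutomaton.fundamental Sg (R.setD L)).rules
  | i + 1 => satRules R Sg L i ∪
      {ρ | ∃ (l r : Term ar) (e : ℕ → Term ar) (c : Term ar), (l, r) ∈ R.rules ∧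
        (∀ x ∈ l.vars, e x ∈ subLang (L ∪ R.setE)) ∧
        c ∈ (TreeAutomaton.fundamental Sg (R.setD L)).states ∧
        Reduces (satRules R Sg L i)
          ((l.lift (Term ar)).subst fun x => stateTerm ar (e x)) (stateTerm ar c) ∧
        ρ = lambdaRule ar (r.subst e) c}

/-- The automata `C₀, C₁, …` of the saturation procedure. -/
def satAutomaton (R : TRS ar) (Sg : Set F) (L : Set (Term ar)) (i : ℕ) :
    TreeAutomaton ar (Term ar) where
  states := (TreeAutomaton.fundamental Sg (R.setD L)).states
  rules := R.satRules Sg L i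
  final := (TreeAutomaton.fundamental Sg L).final

end TRS

/-! ## Effective preservation of recognizability -/

/-- The universe of symbols: a symbol is a pair of a name and a rank. -/
abbrev RSym : Type := ℕ × ℕ

/-- The rank of a symbol. -/
abbrev rank : RSym → ℕ := Prod.snd

/-- Codes of tree automata whose states are natural numbers: the list of states, the list of final
states, the list of the rules `δ(a₁, …, aₙ) → a`, and the list of the rules `a → a'`. -/
abbrev AutomatonCode : Type :=
  List ℕ × List ℕ × List (RSym × List ℕ × ℕ) × List (ℕ × ℕ)

/-- The tree automaton given by a code.  Entries with a wrong number of arguments are no rules. -/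
def AutomatonCode.toAutomaton (c : AutomatonCode) : TreeAutomaton rank ℕ where
  states := {q | q ∈ c.1}
  rules := {ρ | (∃ (δ : RSym) (as : Fin (rank δ) → ℕ) (a : ℕ),
      (δ, List.ofFn as, a) ∈ c.2.2.1 ∧ ρ = symbolRule rank δ as a) ∨
    (∃ a a' : ℕ, (a, a') ∈ c.2.2.2 ∧ ρ = lambdaRule rank a a')}
  final := {q | q ∈ c.2.1}

/-- `R` effectively preserves recognizability of finite tree languages: an algorithm, given any
ranked alphabet `Sg` that contains `sign(R)` and any finite tree language `L` over `Sg` (as lists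
of symbols and of terms), computes a bottom-up tree automaton over `Sg` that recognizes `R*(L)`. -/
def TRS.IsEPRF (R : TRS rank) : Prop :=
  ∃ f : List RSym × List (List RSym) → AutomatonCode, Computable f ∧
    ∀ (Sg : List RSym) (L : List (Term rank)),
      R.sign ⊆ {δ | δ ∈ Sg} → (∀ t ∈ L, t ∈ groundTerms rank {δ | δ ∈ Sg}) →
        (f (Sg, L.map Term.word)).toAutomaton.IsBTA {δ | δ ∈ Sg} ∧
        (f (Sg, L.map Term.word)).toAutomaton.language {δ | δ ∈ Sg} =
          R.descendants {t | t ∈ L}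

/-!
The states stand for ground terms, and the rule `⟨e(r)⟩ → c` is added only when `c` is reachable
from `⟨e(l)⟩`. Hence `b ⇒* a` in `R` whenever the state `⟨a⟩` reduces to the state `⟨b⟩`, and
whatever is recognized is a descendant of a term of `L`.

Conversely, let `e(l) ⇒ e(r)` be a rewriting step in a recognized term. Since `l` is linear, its
variables can be evaluated independently of each other, so that a run gives one state for each
variable of `l`. The run can be repeated after the step, by one of the added rules, if all these
states belong to `sub(L ∪ E)`. Where the run on `l` uses no added rule, it only builds up terms. At
an added rule, and at the end of the run, the state is a term of `sub(L)` or an instance of a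
subterm of a right-hand side, and in the latter case the part of `l` just read overlaps that
subterm. By the condition on overlaps, the most general unifier maps a variable of `l` in this part
to a variable or to a ground term. In the first case the state at that variable is a subterm of a
value of the instance, which is in `sub(L ∪ E)`, and in the second case it is in `E`.

All this holds for every set of sound rules that is closed under the saturation step, in particular
for a set computed by saturation on the words of the states, where each round is a finite search.
-/

/-! ## Subterms and substitutions -/

namespace Term

variable {F : Type} {ar : F → ℕ}

@[simp] theorem subAt_nil (t : Term ar) : t.subAt [] = some t := by
  cases t <;> rfl

@[simp] theorem subAt_var_cons (x i : ℕ) (α : List ℕ) :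
    (var x : Term ar).subAt (i :: α) = none := rfl

theorem subAt_app_cons (f : F) (ts : Fin (ar f) → Term ar) (i : ℕ) (α : List ℕ) :
    (app f ts).subAt (i :: α) = if h : i < ar f then (ts ⟨i, h⟩).subAt α else none := rfl

@[simp] theorem subAt_app_fin (f : F) (ts : Fin (ar f) → Term ar) (i : Fin (ar f)) (α : List ℕ) :
    (app f ts).subAt (i :: α) = (ts i).subAt α := by
  simp [subAt_app_cons]

theorem subAt_app_cons_eq_some {f : F} {ts : Fin (ar f) → Term ar} {i : ℕ} {α : List ℕ}
    {s : Term ar} (h : (app f ts).subAt (i :: α) = some s) :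
    ∃ j : Fin (ar f), i = j ∧ (ts j).subAt α = some s := by
  rw [subAt_app_cons] at h
  split at h
  · exact ⟨⟨i, ‹_›⟩, rfl, h⟩
  · cases h

theorem subAt_append {t u : Term ar} {α : List ℕ} (h : t.subAt α = some u) (β : List ℕ) :
    t.subAt (α ++ β) = u.subAt β := by
  induction α generalizing t with
  | nil =>
    obtain rfl : t = u := by simpa using h
    rfl
  | cons i α ih =>
    cases t with
    | var x => simp at h
    | app f ts =>
      obtain ⟨j, rfl, hj⟩ := subAt_app_cons_eq_some h
      simpa using ih hj

theorem self_mem_sub (t : Term ar) : t ∈ t.sub := ⟨[], by simp⟩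

theorem sub_trans {s t u : Term ar} (h : s ∈ t.sub) (h' : t ∈ u.sub) : s ∈ u.sub := by
  obtain ⟨α, hα⟩ := h
  obtain ⟨β, hβ⟩ := h'
  exact ⟨β ++ α, by rw [subAt_append hβ, hα]⟩

theorem arg_mem_sub (f : F) (ts : Fin (ar f) → Term ar) (i : Fin (ar f)) :
    ts i ∈ (app f ts).sub := ⟨[(i : ℕ)], by simp⟩

theorem mem_sub_var {x : ℕ} {s : Term ar} : s ∈ (var x : Term ar).sub ↔ s = var x := by
  constructor
  · rintro ⟨α, hα⟩
    cases α <;> simp_all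
  · rintro rfl
    exact self_mem_sub _

theorem mem_sub_app {f : F} {ts : Fin (ar f) → Term ar} {s : Term ar} :
    s ∈ (app f ts).sub ↔ s = app f ts ∨ ∃ i, s ∈ (ts i).sub := by
  constructor
  · rintro ⟨α, hα⟩
    cases α with
    | nil => exact Or.inl (by simpa using hα.symm)
    | cons i α =>
      obtain ⟨j, -, hj⟩ := subAt_app_cons_eq_some hα
      exact Or.inr ⟨j, α, hj⟩
  · rintro (rfl | ⟨i, hi⟩)
    · exact self_mem_sub _
    · exact sub_trans hi (arg_mem_sub f ts i)

@[simp] theorem mem_vars_var {x y : ℕ} : x ∈ (var y : Term ar).vars ↔ x = y := by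
  simp [vars, mem_sub_var]

@[simp] theorem mem_vars_app {f : F} {ts : Fin (ar f) → Term ar} {x : ℕ} :
    x ∈ (app f ts).vars ↔ ∃ i, x ∈ (ts i).vars := by
  simp [vars, mem_sub_app]

theorem vars_subset_of_mem_sub {s t : Term ar} (h : s ∈ t.sub) : s.vars ⊆ t.vars :=
  fun _ hx => sub_trans hx h

theorem symbols_subset_of_mem_sub {s t : Term ar} (h : s ∈ t.sub) : s.symbols ⊆ t.symbols :=
  fun _ ⟨ts, hts⟩ => ⟨ts, sub_trans hts h⟩

theorem mem_symbols_app {f g : F} {ts : Fin (ar f) → Term ar} :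
    g ∈ (app f ts).symbols ↔ g = f ∨ ∃ i, g ∈ (ts i).symbols := by
  constructor
  · rintro ⟨us, hus⟩
    rcases mem_sub_app.1 hus with h | ⟨i, hi⟩
    · cases h
      exact Or.inl rfl
    · exact Or.inr ⟨i, us, hi⟩
  · rintro (rfl | ⟨i, us, hus⟩)
    · exact ⟨ts, self_mem_sub _⟩
    · exact ⟨us, mem_sub_app.2 (Or.inr ⟨i, hus⟩)⟩

theorem isGround_app {f : F} {ts : Fin (ar f) → Term ar} :
    (app f ts).IsGround ↔ ∀ i, (ts i).IsGround := by
  simp only [IsGround, Set.eq_empty_iff_forall_notMem, mem_vars_app, not_exists]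
  exact forall_comm

theorem not_isGround_var (x : ℕ) : ¬ (var x : Term ar).IsGround := fun h => by
  have : x ∈ (var x : Term ar).vars := by simp
  rw [h] at this
  exact this

theorem IsGround.of_mem_sub {s t : Term ar} (ht : t.IsGround) (h : s ∈ t.sub) : s.IsGround :=
  Set.subset_eq_empty (vars_subset_of_mem_sub h) ht

@[simp] theorem subst_var (σ : ℕ → Term ar) (x : ℕ) : (var x).subst σ = σ x := rfl

@[simp] theorem subst_app (σ : ℕ → Term ar) (f : F) (ts : Fin (ar f) → Term ar) :
    (app f ts).subst σ = app f fun i => (ts i).subst σ := rfl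

theorem subst_congr {t : Term ar} {σ τ : ℕ → Term ar} (h : ∀ x ∈ t.vars, σ x = τ x) :
    t.subst σ = t.subst τ := by
  induction t with
  | var x => exact h x (by simp)
  | app f ts ih =>
    simp only [subst_app, app.injEq, heq_eq_eq, true_and]
    exact funext fun i => ih i fun x hx => h x (mem_vars_app.2 ⟨i, hx⟩)

theorem subst_var_eq (t : Term ar) : t.subst var = t := by
  induction t with
  | var x => rfl
  | app f ts ih => simp [ih]

theorem IsGround.subst_eq {t : Term ar} (h : t.IsGround) (σ : ℕ → Term ar) : t.subst σ = t := by
  conv_rhs => rw [← subst_var_eq t]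
  exact subst_congr fun x hx => by rw [h] at hx; exact hx.elim

theorem subAt_subst {t s : Term ar} {α : List ℕ} (h : t.subAt α = some s) (σ : ℕ → Term ar) :
    (t.subst σ).subAt α = some (s.subst σ) := by
  induction α generalizing t with
  | nil => simp_all
  | cons i α ih =>
    cases t with
    | var x => simp at h
    | app f ts =>
      obtain ⟨j, rfl, hj⟩ := subAt_app_cons_eq_some h
      simpa using ih hj

theorem subst_mem_sub_subst {s t : Term ar} (h : s ∈ t.sub) (σ : ℕ → Term ar) :
    s.subst σ ∈ (t.subst σ).sub :=
  let ⟨α, hα⟩ := h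
  ⟨α, subAt_subst hα σ⟩

theorem mem_sub_subst {s t : Term ar} {σ : ℕ → Term ar} (h : s ∈ (t.subst σ).sub) :
    (∃ p ∈ t.sub, s = p.subst σ) ∨ ∃ x ∈ t.vars, s ∈ (σ x).sub := by
  induction t with
  | var x => exact Or.inr ⟨x, by simp, h⟩
  | app f ts ih =>
    rcases mem_sub_app.1 h with rfl | ⟨i, hi⟩
    · exact Or.inl ⟨app f ts, self_mem_sub _, rfl⟩
    · rcases ih i hi with ⟨p, hp, rfl⟩ | ⟨x, hx, hs⟩
      · exact Or.inl ⟨p, mem_sub_app.2 (Or.inr ⟨i, hp⟩), rfl⟩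
      · exact Or.inr ⟨x, mem_vars_app.2 ⟨i, hx⟩, hs⟩

theorem mem_vars_subst {t : Term ar} {σ : ℕ → Term ar} {z : ℕ} :
    z ∈ (t.subst σ).vars ↔ ∃ x ∈ t.vars, z ∈ (σ x).vars := by
  induction t with
  | var x => simp
  | app f ts ih =>
    simp only [subst_app, mem_vars_app, ih]
    constructor
    · rintro ⟨i, x, hx, hz⟩
      exact ⟨x, ⟨i, hx⟩, hz⟩
    · rintro ⟨x, ⟨i, hx⟩, hz⟩
      exact ⟨i, x, hx, hz⟩

theorem finite_positions (t : Term ar) : {α | ∃ s, t.subAt α = some s}.Finite := by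
  induction t with
  | var x =>
    refine (Set.finite_singleton ([] : List ℕ)).subset ?_
    rintro (_ | ⟨i, α⟩) ⟨s, hs⟩
    · rfl
    · simp at hs
  | app f ts ih =>
    refine ((Set.finite_singleton ([] : List ℕ)).union
      (Set.finite_iUnion fun i : Fin (ar f) => (ih i).image (List.cons (i : ℕ)))).subset ?_
    rintro (_ | ⟨i, α⟩) ⟨s, hs⟩
    · exact Or.inl rfl
    · obtain ⟨j, rfl, hj⟩ := subAt_app_cons_eq_some hs
      exact Or.inr (Set.mem_iUnion.2 ⟨j, α, ⟨s, hj⟩, rfl⟩)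

theorem finite_sub (t : Term ar) : t.sub.Finite := by
  induction t with
  | var x => exact (Set.finite_singleton (var x)).subset fun s hs => mem_sub_var.1 hs
  | app f ts ih =>
    refine ((Set.finite_singleton (app f ts)).union (Set.finite_iUnion ih)).subset ?_
    intro s hs
    simpa using mem_sub_app.1 hs

theorem finite_vars (t : Term ar) : t.vars.Finite :=
  t.finite_sub.preimage (f := var) fun _ _ _ _ h => by cases h; rfl

theorem Linear.arg {f : F} {ts : Fin (ar f) → Term ar} (h : (app f ts).Linear) (i : Fin (ar f)) :
    (ts i).Linear := fun x α β hα hβ =>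
  List.cons_injective (h x (i :: α) (i :: β) (by simpa using hα) (by simpa using hβ))

theorem Linear.arg_unique {f : F} {ts : Fin (ar f) → Term ar} (h : (app f ts).Linear)
    {i j : Fin (ar f)} {x : ℕ} (hi : x ∈ (ts i).vars) (hj : x ∈ (ts j).vars) : i = j := by
  obtain ⟨α, hα⟩ := hi
  obtain ⟨β, hβ⟩ := hj
  exact Fin.ext (List.cons.inj (h x (i :: α) (j :: β) (by simpa using hα) (by simpa using hβ))).1

/-- The instances of `p` under the substitutions that map the variables of `p` into `A`. -/
def instances (p : Term ar) (A : Set (Term ar)) : Set (Term ar) :=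
  {t | ∃ e : ℕ → Term ar, (∀ x ∈ p.vars, e x ∈ A) ∧ p.subst e = t}

theorem finite_instances (p : Term ar) {A : Set (Term ar)} (hA : A.Finite) :
    (p.instances A).Finite := by
  induction p with
  | var x =>
    refine hA.subset ?_
    rintro _ ⟨e, he, rfl⟩
    exact he x (by simp)
  | app f ts ih =>
    refine ((Set.Finite.pi' ih).image (app f)).subset ?_
    rintro _ ⟨e, he, rfl⟩
    exact ⟨fun i => (ts i).subst e, fun i => ⟨e, fun x hx => he x (mem_vars_app.2 ⟨i, hx⟩), rfl⟩,
      rfl⟩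

/-! ## Shapes -/

/-- `K.Fits t` says that `t` has the symbols of `K` at the positions where `K` has symbols; the
variables of `K` may repeat without any constraint on `t`. -/
def Fits : Term ar → Term ar → Prop
  | var _, _ => True
  | app f Ks, t => ∃ ts : Fin (ar f) → Term ar, t = app f ts ∧ ∀ i, Fits (Ks i) (ts i)

theorem fits_app {f : F} {Ks ts : Fin (ar f) → Term ar} :
    (app f Ks).Fits (app f ts) ↔ ∀ i, (Ks i).Fits (ts i) := by
  constructor
  · rintro ⟨us, h, hus⟩
    cases h
    exact hus
  · exact fun h => ⟨ts, rfl, h⟩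

theorem Fits.trans {s t u : Term ar} (h : s.Fits t) (h' : t.Fits u) : s.Fits u := by
  induction s generalizing t u with
  | var x => trivial
  | app f ss ih =>
    obtain ⟨ts, rfl, hts⟩ := h
    obtain ⟨us, rfl, hus⟩ := h'
    exact fits_app.2 fun i => ih i (hts i) (hus i)

theorem fits_subst (K : Term ar) (σ : ℕ → Term ar) : K.Fits (K.subst σ) := by
  induction K with
  | var _ => trivial
  | app f Ks ih => exact fits_app.2 ih

theorem Supertree.fits {u v : Term ar} (h : u.Supertree v) : u.Fits v := by
  obtain ⟨-, σ, rfl⟩ := h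
  exact fits_subst u σ

theorem Fits.exists_subAt {K t : Term ar} (h : K.Fits t) {γ : List ℕ} {u : Term ar}
    (hu : K.subAt γ = some u) : ∃ s, t.subAt γ = some s := by
  induction K generalizing t γ with
  | var x =>
    cases γ with
    | nil => exact ⟨t, by simp⟩
    | cons i γ => simp at hu
  | app f Ks ih =>
    obtain ⟨ts, rfl, hts⟩ := h
    cases γ with
    | nil => exact ⟨_, subAt_nil _⟩
    | cons i γ =>
      obtain ⟨j, rfl, hj⟩ := subAt_app_cons_eq_some hu
      simpa using ih j (hts j) hj

theorem Fits.isVar_of_subAt_eq_var {K t u : Term ar} (h : K.Fits t) {γ : List ℕ} {x : ℕ}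
    (hu : K.subAt γ = some u) (ht : t.subAt γ = some (var x)) : u.IsVar := by
  induction K generalizing t γ with
  | var y =>
    cases γ with
    | nil => exact ⟨y, by simpa using hu.symm⟩
    | cons i γ => simp at hu
  | app f Ks ih =>
    obtain ⟨ts, rfl, hts⟩ := h
    cases γ with
    | nil => simp at ht
    | cons i γ =>
      obtain ⟨j, rfl, hj⟩ := subAt_app_cons_eq_some hu
      exact ih j (hts j) hj (by simpa using ht)

theorem Fits.subst_eq {K t : Term ar} (h : K.Fits t) {θ : ℕ → Term ar}
    (hθ : ∀ γ y, K.subAt γ = some (var y) → t.subAt γ = some (θ y)) : K.subst θ = t := by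
  induction K generalizing t with
  | var x => simpa using (hθ [] x (by simp)).symm
  | app f Ks ih =>
    obtain ⟨ts, rfl, hts⟩ := h
    simp only [subst_app, app.injEq, heq_eq_eq, true_and]
    exact funext fun i => ih i (hts i) fun γ y hy => by
      simpa using hθ (i :: γ) y (by simpa using hy)

theorem Linear.exists_subst_eq {K t : Term ar} (hK : K.Linear) (h : K.Fits t) (e : ℕ → Term ar) :
    ∃ θ : ℕ → Term ar, K.subst θ = t ∧ ∀ x ∉ K.vars, θ x = e x := by
  have hval (x : ℕ) : ∃ u, (∀ γ, K.subAt γ = some (var x) → t.subAt γ = some u) ∧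
      (x ∉ K.vars → u = e x) := by
    by_cases hx : x ∈ K.vars
    · obtain ⟨γ, hγ⟩ := hx
      obtain ⟨u, hu⟩ := h.exists_subAt hγ
      exact ⟨u, fun δ hδ => hK x γ δ hγ hδ ▸ hu, fun hn => absurd ⟨γ, hγ⟩ hn⟩
    · exact ⟨e x, fun γ hγ => absurd ⟨γ, hγ⟩ hx, fun _ => rfl⟩
  choose θ hθ he using hval
  exact ⟨θ, h.subst_eq fun γ y => hθ y γ, he⟩

/-- The shape of a term: all variables are identified. -/
def shape (t : Term ar) : Term ar := t.subst fun _ => var 0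

theorem fits_of_shape_eq {s t : Term ar} (h : s.shape = t.shape) : s.Fits t := by
  induction s generalizing t with
  | var x => trivial
  | app f ss ih =>
    cases t with
    | var y => simp [shape] at h
    | app g ts =>
      simp only [shape, subst_app, app.injEq] at h
      obtain ⟨rfl, h⟩ := h
      exact fits_app.2 fun i => ih i (congrFun (eq_of_heq h) i)

theorem exists_subAt_eq_var_of_shape_eq {s t : Term ar} (h : s.shape = t.shape) {γ : List ℕ}
    {x : ℕ} (hs : s.subAt γ = some (var x)) : ∃ y, t.subAt γ = some (var y) := by
  obtain ⟨u, hu⟩ := (fits_of_shape_eq h).exists_subAt hs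
  obtain ⟨y, rfl⟩ := (fits_of_shape_eq h.symm).isVar_of_subAt_eq_var hu hs
  exact ⟨y, hu⟩

theorem finite_shapes (t : Term ar) : (shape '' {s | s.Fits t}).Finite := by
  induction t with
  | var x =>
    refine (Set.finite_singleton (var 0)).subset ?_
    rintro _ ⟨s, hs, rfl⟩
    cases s with
    | var y => rfl
    | app f ss =>
      obtain ⟨ts, h, -⟩ := hs
      cases h
  | app f ts ih =>
    refine ((Set.finite_singleton (var 0)).union ((Set.Finite.pi' ih).image (app f))).subset ?_
    rintro _ ⟨s, hs, rfl⟩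
    cases s with
    | var y => exact Or.inl rfl
    | app g ss =>
      obtain ⟨us, h, hus⟩ := hs
      cases h
      exact Or.inr ⟨fun i => (ss i).shape, fun i => ⟨ss i, hus i, rfl⟩, rfl⟩

/-- Relabelling: the variable at the position `γ` becomes `g γ`. -/
def label (g : List ℕ → ℕ) : Term ar → Term ar
  | var _ => var (g [])
  | app f ts => app f fun i => label (fun γ => g (i :: γ)) (ts i)

theorem eq_of_subAt_label {K : Term ar} {g : List ℕ → ℕ} {γ : List ℕ} {y : ℕ}
    (h : (K.label g).subAt γ = some (var y)) : y = g γ := by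
  induction K generalizing g γ with
  | var x =>
    cases γ with
    | nil => simpa [label] using h.symm
    | cons i γ => simp [label] at h
  | app f Ks ih =>
    cases γ with
    | nil => simp [label] at h
    | cons i γ =>
      obtain ⟨j, rfl, hj⟩ := subAt_app_cons_eq_some h
      exact ih j (g := fun γ => g (j :: γ)) hj

theorem shape_label (K : Term ar) (g : List ℕ → ℕ) : (K.label g).shape = K.shape := by
  induction K generalizing g with
  | var x => rfl
  | app f Ks ih => exact congrArg (app f) (funext fun i => ih i _)

theorem exists_linear_variant (K : Term ar) {V : Set ℕ} (hV : V.Finite) :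
    ∃ K' : Term ar, K'.Linear ∧ Disjoint K'.vars V ∧ K'.shape = K.shape := by
  obtain ⟨n, hn⟩ := hV.bddAbove
  let g (γ : List ℕ) : ℕ := Encodable.encode γ + (n + 1)
  have hg : g.Injective := fun _ _ h => Encodable.encode_injective (Nat.add_right_cancel h)
  refine ⟨K.label g, fun x α β hα hβ => ?_, Set.disjoint_left.2 ?_, K.shape_label g⟩
  · exact hg ((eq_of_subAt_label hα).symm.trans (eq_of_subAt_label hβ))
  · rintro x ⟨γ, hγ⟩ hx
    have hgn : g γ ≤ n := eq_of_subAt_label hγ ▸ hn hx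
    exact Nat.not_succ_le_self n ((Nat.le_add_left (n + 1) _).trans hgn)

end Term

section SubLang

variable {F : Type} {ar : F → ℕ} {L : Set (Term ar)}

theorem subset_subLang (L : Set (Term ar)) : L ⊆ subLang L :=
  fun t ht => Set.mem_biUnion ht t.self_mem_sub

theorem subLang_mono {L' : Set (Term ar)} (h : L ⊆ L') : subLang L ⊆ subLang L' :=
  Set.biUnion_subset_biUnion_left h

theorem mem_subLang_of_mem_sub {s t : Term ar} (ht : t ∈ subLang L) (hs : s ∈ t.sub) :
    s ∈ subLang L := by
  obtain ⟨u, hu, htu⟩ := Set.mem_iUnion₂.1 ht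
  exact Set.mem_iUnion₂.2 ⟨u, hu, Term.sub_trans hs htu⟩

theorem finite_subLang (h : L.Finite) : (subLang L).Finite := h.biUnion fun t _ => t.finite_sub

end SubLang

/-! ## Most general unifiers -/

namespace Term

variable {F : Type} {ar : F → ℕ} {U : Type*}

/-- The argument number `i` of a term, or the term itself if it has no such argument. -/
def argAt (i : ℕ) (t : Term ar) : Term ar := (t.subAt [i]).getD t

theorem argAt_app (f : F) (ts : Fin (ar f) → Term ar) (i : Fin (ar f)) :
    argAt i (app f ts) = ts i := by
  simp [argAt]

open Classical in
/-- The generalization of a family `φ` of terms, by recursion on one of its members: it has the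
common symbols of the family, and a subfamily without a common symbol at the root is replaced by the
variable that `name` gives to it. -/
noncomputable def gen (name : (U → Term ar) → ℕ) : Term ar → (U → Term ar) → Term ar
  | var _, φ => var (name φ)
  | app f ts, φ =>
    if ∀ θ, ∃ us : Fin (ar f) → Term ar, φ θ = app f us then
      app f fun i => gen name (ts i) fun θ => argAt i (φ θ)
    else var (name φ)

theorem gen_app (name : (U → Term ar) → ℕ) (θ₀ : U) {f : F} (φ : Fin (ar f) → U → Term ar) :
    gen name (app f fun i => φ i θ₀) (fun θ => app f fun i => φ i θ) =
      app f fun i => gen name (φ i θ₀) (φ i) := by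
  rw [gen, if_pos fun θ => ⟨_, rfl⟩]
  simp only [argAt_app]

theorem gen_subst (name : (U → Term ar) → ℕ) (θ₀ : U) (val : U → ℕ → Term ar) (s : Term ar) :
    gen name (s.subst (val θ₀)) (fun θ => s.subst (val θ)) =
      s.subst fun x => gen name (val θ₀ x) fun θ => val θ x := by
  induction s with
  | var x => rfl
  | app f ts ih =>
    simp only [subst_app]
    rw [gen_app name θ₀ fun i θ => (ts i).subst (val θ)]
    simp only [ih]

/-- The family `φ` consists of the subterms of the terms `val θ x` at a common position, for a fixed
variable `x`. -/
def IsComponent (val : U → ℕ → Term ar) (φ : U → Term ar) : Prop :=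
  ∃ (x : ℕ) (α : List ℕ), ∀ θ, (val θ x).subAt α = some (φ θ)

theorem countable_isComponent (val : U → ℕ → Term ar) : {φ | IsComponent val φ}.Countable := by
  have hunion : {φ | IsComponent val φ} =
      ⋃ (x : ℕ) (α : List ℕ), {φ | ∀ θ, (val θ x).subAt α = some (φ θ)} := by
    ext φ
    simp [IsComponent]
  rw [hunion]
  refine Set.countable_iUnion fun x => Set.countable_iUnion fun α =>
    Set.Subsingleton.countable fun φ hφ ψ hψ => funext fun θ => ?_
  exact Option.some.inj ((hφ θ).symm.trans (hψ θ))

theorem isComponent_self (val : U → ℕ → Term ar) (x : ℕ) : IsComponent val fun θ => val θ x :=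
  ⟨x, [], fun _ => subAt_nil _⟩

theorem IsComponent.arg {val : U → ℕ → Term ar} {φ : U → Term ar} (hφ : IsComponent val φ) {f : F}
    {us : U → Fin (ar f) → Term ar} (hus : ∀ θ, φ θ = app f (us θ)) (i : Fin (ar f)) :
    IsComponent val fun θ => us θ i := by
  obtain ⟨x, α, h⟩ := hφ
  exact ⟨x, α ++ [(i : ℕ)], fun θ => by rw [subAt_append (h θ), hus θ]; simp⟩

theorem subst_gen {name : (U → Term ar) → ℕ} {val : U → ℕ → Term ar} {τ : ℕ → Term ar} {θ : U}
    (hτ : ∀ φ, IsComponent val φ → τ (name φ) = φ θ) {φ : U → Term ar} (hφ : IsComponent val φ)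
    (θ₀ : U) : (gen name (φ θ₀) φ).subst τ = φ θ := by
  obtain ⟨t, ht⟩ : ∃ t, φ θ₀ = t := ⟨_, rfl⟩
  rw [ht]
  induction t generalizing φ with
  | var x => exact hτ φ hφ
  | app f ts ih =>
    rw [gen]
    split_ifs with h
    · choose us hus using h
      have hts : us θ₀ = ts := by simpa using (hus θ₀).symm.trans ht
      rw [hus θ, subst_app]
      congr 1
      funext i
      simpa only [hus, argAt_app] using ih i (hφ.arg hus i) (congrFun hts i)
    · exact hτ φ hφ

theorem exists_generalization [Nonempty U] (val : U → ℕ → Term ar) :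
    ∃ σ : ℕ → Term ar,
      (∀ s t : Term ar, (∀ θ, s.subst (val θ) = t.subst (val θ)) → s.subst σ = t.subst σ) ∧
        ∀ θ, ∃ τ : ℕ → Term ar, ∀ x, val θ x = (σ x).subst τ := by
  obtain ⟨θ₀⟩ := ‹Nonempty U›
  obtain ⟨name, hname⟩ := Set.countable_iff_exists_injOn.1 (countable_isComponent val)
  refine ⟨fun x => gen name (val θ₀ x) fun θ => val θ x, fun s t h => ?_, fun θ => ?_⟩
  · rw [← gen_subst name θ₀ val s, ← gen_subst name θ₀ val t, funext h, h θ₀]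
  · have : Nonempty (U → Term ar) := ⟨fun _ => var 0⟩
    refine ⟨fun n => Function.invFunOn name {φ | IsComponent val φ} n θ, fun x => ?_⟩
    refine (subst_gen (fun φ hφ => ?_) (isComponent_self val x) θ₀).symm
    rw [hname.leftInvOn_invFunOn hφ]

/-- A most general unifier is a least general common generalization of all unifiers. -/
theorem exists_isMGU {s t : Term ar} {θ : ℕ → Term ar} (h : s.subst θ = t.subst θ) :
    ∃ σ, IsMGU σ s t := by
  have : Nonempty {θ : ℕ → Term ar // s.subst θ = t.subst θ} := ⟨⟨θ, h⟩⟩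
  obtain ⟨σ, hσ, hgen⟩ :=
    exists_generalization (Subtype.val : {θ : ℕ → Term ar // s.subst θ = t.subst θ} → _)
  exact ⟨σ, hσ s t Subtype.prop, fun θ hθ => hgen ⟨θ, hθ⟩⟩

end Term

/-! ## Finiteness of `E` and `D` -/

namespace Term

variable {F : Type} {ar : F → ℕ}

/-- The ground terms that a most general unifier of `u` and some linear term of the shape `K`, whose
variables do not occur in `u`, assigns to the variable at the position `γ` of the linear term. -/
def groundUnifierValues (u K : Term ar) (γ : List ℕ) : Set (Term ar) :=
  {t | t.IsGround ∧ ∃ (l : Term ar) (σ : ℕ → Term ar) (y : ℕ), l.Linear ∧ l.shape = K ∧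
    Disjoint l.vars u.vars ∧ IsMGU σ u l ∧ l.subAt γ = some (var y) ∧ σ y = t}

theorem subsingleton_groundUnifierValues (u K : Term ar) (γ : List ℕ) :
    (groundUnifierValues u K γ).Subsingleton := by
  rintro _ ⟨hg, l, σ, y, hlin, hK, hd, hσ, hy, rfl⟩ _ ⟨-, l', σ', y', -, hK', -, hσ', hy', rfl⟩
  have hfit : l.Fits (l'.subst σ') := (fits_of_shape_eq (hK.trans hK'.symm)).trans (fits_subst _ _)
  obtain ⟨θ, hθ, hθσ'⟩ := hlin.exists_subst_eq hfit σ'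
  have huθ : u.subst θ = u.subst σ' :=
    subst_congr fun x hx => hθσ' x fun hl => Set.disjoint_left.1 hd hl hx
  obtain ⟨τ, hτ⟩ := hσ.2 θ (by rw [huθ, hθ, hσ'.1])
  have hval : θ y = σ' y' :=
    Option.some.inj ((subAt_subst hy θ).symm.trans (hθ ▸ subAt_subst hy' σ'))
  rw [← hval, hτ, hg.subst_eq]

end Term

namespace TRS

open Term

variable {F : Type} {ar : F → ℕ}

theorem mem_groundUnifierValues_of_mem_setE {R : TRS ar} {t : Term ar} (ht : t ∈ R.setE) :
    ∃ ρ₁ ∈ R.rules, ∃ u ∈ ρ₁.2.sub, ∃ ρ₂ ∈ R.rules, ∃ v ∈ ρ₂.1.sub,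
      ∃ γ ∈ {γ | ∃ s, v.subAt γ = some s}, ∃ K ∈ shape '' {s | s.Fits v},
        t ∈ groundUnifierValues u K γ := by
  obtain ⟨hg, l₂, β, l₃, σ, ⟨l₁, r₁, r₂, h₁, h₂, α, u, v, hu, hv, -, hsup, hd, hσ⟩, -, γ, w, hw,
    ⟨x, hx⟩, rfl⟩ := ht
  rw [subAt_append hv] at hx
  obtain ⟨y, rfl⟩ := hsup.fits.isVar_of_subAt_eq_var hw hx
  have hul : u.vars ⊆ l₁.vars := (vars_subset_of_mem_sub ⟨α, hu⟩).trans (R.vars_subset _ _ h₁)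
  exact ⟨(l₁, r₁), h₁, u, ⟨α, hu⟩, (l₂, r₂), h₂, v, ⟨β, hv⟩, γ, ⟨_, hx⟩, l₃.shape,
    ⟨l₃, hsup.fits, rfl⟩, hg, l₃, σ, y, hsup.1, rfl, hd.mono_right hul, hσ, hw, rfl⟩

theorem finite_setE (R : TRS ar) : R.setE.Finite := by
  have hfin : (⋃ ρ₁ ∈ R.rules, ⋃ u ∈ ρ₁.2.sub, ⋃ ρ₂ ∈ R.rules, ⋃ v ∈ ρ₂.1.sub,
      ⋃ γ ∈ {γ | ∃ s, v.subAt γ = some s}, ⋃ K ∈ shape '' {s | s.Fits v},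
        groundUnifierValues u K γ).Finite :=
    R.finite.biUnion fun ρ₁ _ => (finite_sub ρ₁.2).biUnion fun u _ => R.finite.biUnion
      fun ρ₂ _ => (finite_sub ρ₂.1).biUnion fun v _ => (finite_positions v).biUnion fun γ _ =>
      (finite_shapes v).biUnion fun K _ => (subsingleton_groundUnifierValues u K γ).finite
  refine hfin.subset fun t ht => ?_
  simpa only [Set.mem_iUnion, exists_prop] using mem_groundUnifierValues_of_mem_setE ht

/-- The set `sub(L ∪ E)` of the values that the substitutions of the saturation procedure may
take. -/
def values (R : TRS ar) (L : Set (Term ar)) : Set (Term ar) := subLang (L ∪ R.setE)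

/-- The instances of the right-hand sides under substitutions with values in `sub(L ∪ E)`. -/
def rhsInstances (R : TRS ar) (L : Set (Term ar)) : Set (Term ar) :=
  ⋃ ρ ∈ R.rules, ρ.2.instances (R.values L)

variable {R : TRS ar} {L : Set (Term ar)}

theorem mem_values_of_mem_sub {s t : Term ar} (ht : t ∈ R.values L) (hs : s ∈ t.sub) :
    s ∈ R.values L :=
  mem_subLang_of_mem_sub ht hs

theorem finite_values (R : TRS ar) (hL : L.Finite) : (R.values L).Finite :=
  finite_subLang (hL.union R.finite_setE)

theorem subst_mem_rhsInstances {l r : Term ar} {e : ℕ → Term ar} (h : (l, r) ∈ R.rules)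
    (he : ∀ x ∈ l.vars, e x ∈ R.values L) : r.subst e ∈ R.rhsInstances L :=
  Set.mem_biUnion h ⟨e, fun x hx => he x (R.vars_subset l r h hx), rfl⟩

theorem mem_setD_iff {t : Term ar} :
    t ∈ R.setD L ↔
      t ∈ subLang L ∨ ∃ ρ ∈ R.rules, ∃ p ∈ ρ.2.sub, t ∈ p.instances (R.values L) := by
  refine or_congr_right ⟨?_, ?_⟩
  · rintro ⟨l, r, p, e, h, hp, he, rfl⟩
    exact ⟨(l, r), h, p, hp, e, he, rfl⟩
  · rintro ⟨⟨l, r⟩, h, p, hp, e, he, rfl⟩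
    exact ⟨l, r, p, e, h, hp, he, rfl⟩

theorem rhsInstances_subset_setD : R.rhsInstances L ⊆ R.setD L := fun _ ht =>
  let ⟨ρ, hρ, hp⟩ := Set.mem_iUnion₂.1 ht
  mem_setD_iff.2 (Or.inr ⟨ρ, hρ, ρ.2, self_mem_sub _, hp⟩)

theorem subset_setD : L ⊆ R.setD L := fun _ ht => Or.inl (subset_subLang L ht)

theorem mem_setD_of_mem_sub {s t : Term ar} (ht : t ∈ R.setD L) (hs : s ∈ t.sub) :
    s ∈ R.setD L := by
  rcases mem_setD_iff.1 ht with ht | ⟨ρ, hρ, p, hp, e, he, rfl⟩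
  · exact Or.inl (mem_subLang_of_mem_sub ht hs)
  refine mem_setD_iff.2 (Or.inr ⟨ρ, hρ, ?_⟩)
  rcases mem_sub_subst hs with ⟨q, hq, rfl⟩ | ⟨x, hx, hsx⟩
  · exact ⟨q, sub_trans hq hp, e, fun x hx => he x (vars_subset_of_mem_sub hq hx), rfl⟩
  · refine ⟨var x, sub_trans hx hp, fun _ => s, fun _ _ => ?_, rfl⟩
    exact mem_values_of_mem_sub (he x hx) hsx

theorem subLang_setD (R : TRS ar) (L : Set (Term ar)) : subLang (R.setD L) = R.setD L :=
  (Set.iUnion₂_subset fun _ ht _ hs => mem_setD_of_mem_sub ht hs).antisymm (subset_subLang _)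

theorem finite_setD (R : TRS ar) (hL : L.Finite) : (R.setD L).Finite := by
  refine ((finite_subLang hL).union (R.finite.biUnion fun ρ _ => (finite_sub ρ.2).biUnion
    fun p _ => finite_instances p (R.finite_values hL))).subset fun t ht => ?_
  simpa only [Set.mem_union, Set.mem_iUnion, exists_prop] using mem_setD_iff.1 ht

theorem isGround_of_mem_values (hL : ∀ t ∈ L, t.IsGround) {t : Term ar}
    (ht : t ∈ R.values L) : t.IsGround := by
  obtain ⟨s, hs, hts⟩ := Set.mem_iUnion₂.1 ht
  exact IsGround.of_mem_sub (hs.elim (hL s) fun hs => hs.1) hts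

theorem isGround_of_mem_setD (hL : ∀ t ∈ L, t.IsGround) {t : Term ar}
    (ht : t ∈ R.setD L) : t.IsGround := by
  rcases mem_setD_iff.1 ht with ht | ⟨_, -, _, -, e, he, rfl⟩
  · obtain ⟨s, hs, hts⟩ := Set.mem_iUnion₂.1 ht
    exact IsGround.of_mem_sub (hL s hs) hts
  · refine Set.eq_empty_of_forall_notMem fun z hz => ?_
    obtain ⟨x, hx, hzx⟩ := mem_vars_subst.1 hz
    exact (isGround_of_mem_values hL (he x hx)).subset hzx

end TRS

/-! ## Rewriting -/

section Rewriting

open Term Relation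

variable {F : Type} {ar : F → ℕ} {Sg : Set F}

theorem app_mem_groundTerms {f : F} {ts : Fin (ar f) → Term ar} :
    app f ts ∈ groundTerms ar Sg ↔ f ∈ Sg ∧ ∀ i, ts i ∈ groundTerms ar Sg := by
  refine ⟨fun h => ⟨h.2 (mem_symbols_app.2 (Or.inl rfl)), fun i => ⟨isGround_app.1 h.1 i,
    (symbols_subset_of_mem_sub (arg_mem_sub f ts i)).trans h.2⟩⟩, fun h =>
    ⟨isGround_app.2 fun i => (h.2 i).1, fun g hg => ?_⟩⟩
  rcases mem_symbols_app.1 hg with rfl | ⟨i, hi⟩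
  · exact h.1
  · exact (h.2 i).2 hi

theorem mem_groundTerms_of_mem_sub {s t : Term ar} (ht : t ∈ groundTerms ar Sg) (hs : s ∈ t.sub) :
    s ∈ groundTerms ar Sg :=
  ⟨ht.1.of_mem_sub hs, (symbols_subset_of_mem_sub hs).trans ht.2⟩

theorem subst_mem_groundTerms {t : Term ar} {σ : ℕ → Term ar} (ht : t.symbols ⊆ Sg)
    (hσ : ∀ x ∈ t.vars, σ x ∈ groundTerms ar Sg) : t.subst σ ∈ groundTerms ar Sg := by
  induction t with
  | var x => exact hσ x (by simp)
  | app f ts ih =>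
    exact app_mem_groundTerms.2 ⟨ht (mem_symbols_app.2 (Or.inl rfl)), fun i =>
      ih i ((symbols_subset_of_mem_sub (arg_mem_sub f ts i)).trans ht) fun x hx =>
        hσ x (mem_vars_app.2 ⟨i, hx⟩)⟩

theorem Step.mem_groundTerms {R : TRS ar} (hSg : R.sign ⊆ Sg) {s t : Term ar}
    (h : Step R.rules s t) (hs : s ∈ groundTerms ar Sg) : t ∈ groundTerms ar Sg := by
  induction h with
  | root l r σ hlr =>
    exact subst_mem_groundTerms (fun f hf => hSg ⟨l, r, hlr, Or.inr hf⟩) fun x hx =>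
      mem_groundTerms_of_mem_sub hs (subst_mem_sub_subst (R.vars_subset l r hlr hx) σ)
  | arg f ts i s _ ih =>
    rw [app_mem_groundTerms] at hs ⊢
    exact ⟨hs.1, (Function.forall_update_iff ts fun _ u => u ∈ groundTerms ar Sg).2
      ⟨ih (hs.2 i), fun j _ => hs.2 j⟩⟩

theorem Reduces.mem_groundTerms {R : TRS ar} (hSg : R.sign ⊆ Sg) {s t : Term ar}
    (h : Reduces R.rules s t) (hs : s ∈ groundTerms ar Sg) : t ∈ groundTerms ar Sg := by
  induction h with
  | refl => exact hs
  | tail _ h ih => exact h.mem_groundTerms hSg ih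

variable {R : Set (Term ar × Term ar)}

theorem Reduces.update {f : F} (ts : Fin (ar f) → Term ar) (i : Fin (ar f)) {s : Term ar}
    (h : Reduces R (ts i) s) : Reduces R (app f ts) (app f (Function.update ts i s)) := by
  induction h with
  | refl => rw [Function.update_eq_self]; exact ReflTransGen.refl
  | @tail s' s _ hstep ih =>
    refine ih.tail ?_
    have := Step.arg f (Function.update ts i s') i s (by rwa [Function.update_self])
    rwa [Function.update_idem] at this

theorem Reduces.app {f : F} {ts us : Fin (ar f) → Term ar} (h : ∀ i, Reduces R (ts i) (us i)) :
    Reduces R (app f ts) (app f us) := by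
  have hpiecewise (S : Finset (Fin (ar f))) :
      Reduces R (Term.app f ts) (Term.app f (S.piecewise us ts)) := by
    induction S using Finset.induction_on with
    | empty => rw [Finset.piecewise_empty]; exact ReflTransGen.refl
    | insert j S hj ih =>
      rw [Finset.piecewise_insert]
      exact ih.trans (Reduces.update _ j
        (by rw [Finset.piecewise_eq_of_notMem _ _ _ hj]; exact h j))
  simpa using hpiecewise Finset.univ

theorem TreeAutomaton.language_eq_descendants {Q : Type} {R : TRS ar} {L : Set (Term ar)}
    (hSg : R.sign ⊆ Sg) (hL : L ⊆ groundTerms ar Sg) {A : TreeAutomaton ar Q} {φ : Term ar → Q}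
    (hfinal : A.final = φ '' L)
    (hred : ∀ p ∈ L, ∀ t : Term ar, t.IsGround →
      (Reduces A.rules (t.lift Q) (stateTerm ar (φ p)) ↔ Reduces R.rules p t)) :
    A.language Sg = R.descendants L := by
  ext t
  constructor
  · rintro ⟨ht, q, hq, h⟩
    obtain ⟨p, hp, rfl⟩ := hfinal ▸ hq
    exact ⟨p, hp, (hred p hp t ht.1).1 h⟩
  · rintro ⟨p, hp, h⟩
    have ht := h.mem_groundTerms hSg (hL hp)
    exact ⟨ht, φ p, hfinal ▸ ⟨p, hp, rfl⟩, (hred p hp t ht.1).2 h⟩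

end Rewriting

/-! ## Runs of tree automata -/

/-- The transitions of a tree automaton with the states `Q`: `move f as a` stands for the rule
`f(as) → a`, and `eps a b` for the rule `a → b`. -/
structure Transitions {F : Type} (ar : F → ℕ) (Q : Type) where
  move : (f : F) → (Fin (ar f) → Q) → Q → Prop
  eps : Q → Q → Prop

namespace Transitions

open Term Relation

variable {F : Type} {ar : F → ℕ} {Q : Type} (T : Transitions ar Q)

/-- The rewrite rules that the transitions stand for. -/
def rules : Set (Term (stateRank ar Q) × Term (stateRank ar Q)) :=
  {ρ | (∃ f as a, T.move f as a ∧ ρ = symbolRule ar f as a) ∨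
    ∃ a b, T.eps a b ∧ ρ = lambdaRule ar a b}

/-- `T.Run V t q` says that the term `t` can be evaluated to the state `q` if the possible values of
its variables are given by `V`. A ground term is evaluated with `V = ⊥`. -/
def Run (V : ℕ → Q → Prop) : Term ar → Q → Prop
  | var x, q => V x q
  | app f ts, q => ∃ (as : Fin (ar f) → Q) (a : Q), T.move f as a ∧
      (∀ i, Run V (ts i) (as i)) ∧ ReflTransGen T.eps a q

/-- The evaluation of a term that contains states to a state. -/
def Eval : Term (stateRank ar Q) → Q → Prop
  | var _, _ => False
  | app (Sum.inr p) _, q => ReflTransGen T.eps p q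
  | app (Sum.inl f) ts, q => ∃ (as : Fin (ar f) → Q) (a : Q), T.move f as a ∧
      (∀ i : Fin (ar f), Eval (ts i) (as i)) ∧ ReflTransGen T.eps a q

variable {T} {V W : ℕ → Q → Prop}

theorem Run.mono {t : Term ar} {q : Q} (h : T.Run V t q)
    (hVW : ∀ x ∈ t.vars, ∀ q, V x q → W x q) : T.Run W t q := by
  induction t generalizing q with
  | var x => exact hVW x (by simp) q h
  | app f ts ih =>
    obtain ⟨as, a, hmove, has, ha⟩ := h
    exact ⟨as, a, hmove, fun i => ih i (has i) fun x hx => hVW x (mem_vars_app.2 ⟨i, hx⟩), ha⟩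

theorem run_subst {t : Term ar} {θ : ℕ → Term ar} {q : Q} :
    T.Run V (t.subst θ) q ↔ T.Run (fun x => T.Run V (θ x)) t q := by
  induction t generalizing q with
  | var x => rfl
  | app f ts ih => simp only [subst_app, Run, ih]

theorem Run.trans (hV : ∀ x a b, V x a → T.eps a b → V x b) {t : Term ar} {a b : Q}
    (h : T.Run V t a) (hab : ReflTransGen T.eps a b) : T.Run V t b := by
  cases t with
  | var x =>
    induction hab with
    | refl => exact h
    | tail _ h2 ih => exact hV _ _ _ ih h2
  | app f ts =>
    obtain ⟨as, c, hmove, has, hc⟩ := h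
    exact ⟨as, c, hmove, has, hc.trans hab⟩

theorem Run.exists_valuation {t : Term ar} (ht : t.Linear) {q : Q} (h : T.Run V t q) :
    ∃ s : ℕ → Q, (∀ x ∈ t.vars, V x (s x)) ∧ T.Run (fun x q => q = s x) t q := by
  classical
  induction t generalizing q with
  | var x => exact ⟨fun _ => q, fun y hy => mem_vars_var.1 hy ▸ h, rfl⟩
  | app f ts ih =>
    obtain ⟨as, a, hmove, has, ha⟩ := h
    choose s hV hrun using fun i => ih i (ht.arg i) (has i)
    let s' (x : ℕ) : Q := if hx : ∃ i, x ∈ (ts i).vars then s hx.choose x else q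
    have hs' {i : Fin (ar f)} {x : ℕ} (hx : x ∈ (ts i).vars) : s' x = s i x := by
      have hex : ∃ i, x ∈ (ts i).vars := ⟨i, hx⟩
      simp only [s', dif_pos hex, ht.arg_unique hex.choose_spec hx]
    refine ⟨s', fun x hx => ?_, as, a, hmove, fun i => ?_, ha⟩
    · obtain ⟨i, hi⟩ := mem_vars_app.1 hx
      exact hs' hi ▸ hV i x hi
    · exact (hrun i).mono fun x hx q hq => hq.trans (hs' hx).symm

theorem lambdaRule_mem_rules {a b : Q} : lambdaRule ar a b ∈ T.rules ↔ T.eps a b := by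
  refine ⟨?_, fun h => Or.inr ⟨a, b, h, rfl⟩⟩
  rintro (⟨f, as, c, -, h⟩ | ⟨a', b', h, hab⟩)
  · cases (app.inj (congrArg Prod.fst h)).1
  · cases (app.inj (congrArg Prod.fst hab)).1
    cases (app.inj (congrArg Prod.snd hab)).1
    exact h

theorem stateTerm_subst (q : Q) (σ : ℕ → Term (stateRank ar Q)) :
    (stateTerm ar q).subst σ = stateTerm ar q :=
  congrArg (app (ar := stateRank ar Q) (Sum.inr q)) (funext fun i => Fin.elim0 i)

theorem step_of_eps {a b : Q} (h : T.eps a b) :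
    Step T.rules (stateTerm ar a) (stateTerm ar b) := by
  simpa only [stateTerm_subst] using
    Step.root (R := T.rules) (stateTerm ar a) (stateTerm ar b) var (Or.inr ⟨a, b, h, rfl⟩)

theorem step_of_move {f : F} {as : Fin (ar f) → Q} {a : Q} (h : T.move f as a) :
    Step T.rules (app (ar := stateRank ar Q) (Sum.inl f) fun i => stateTerm ar (as i))
      (stateTerm ar a) := by
  have := Step.root (R := T.rules) _ _ var (Or.inl ⟨f, as, a, h, rfl⟩)
  simpa only [stateTerm_subst, subst_app] using this

theorem reduces_of_reflTransGen_eps {a b : Q} (h : ReflTransGen T.eps a b) :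
    Reduces T.rules (stateTerm ar a) (stateTerm ar b) :=
  ReflTransGen.lift (stateTerm ar) (fun _ _ => step_of_eps) a b h

theorem Eval.of_step {s t : Term (stateRank ar Q)} (h : Step T.rules s t) {q : Q}
    (ht : T.Eval t q) : T.Eval s q := by
  induction h generalizing q with
  | root l r σ hlr =>
    rcases hlr with ⟨f, as, a, hmove, h⟩ | ⟨a, b, hab, h⟩
    · cases h
      rw [stateTerm_subst] at ht
      simp only [subst_app, stateTerm_subst]
      exact ⟨as, a, hmove, fun i => ReflTransGen.refl, ht⟩
    · cases h
      rw [stateTerm_subst] at ht ⊢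
      exact ReflTransGen.head hab ht
  | arg g ts i s h ih =>
    rcases g with f | p
    · obtain ⟨as, a, hmove, has, ha⟩ := ht
      obtain ⟨hi, hne⟩ := (Function.forall_update_iff ts fun j u => T.Eval u (as j)).1 has
      refine ⟨as, a, hmove, fun j => ?_, ha⟩
      by_cases hij : j = i
      · exact hij ▸ ih hi
      · exact hne j hij
    · exact Fin.elim0 i

theorem Eval.reduces {t : Term (stateRank ar Q)} {q : Q} (h : T.Eval t q) :
    Reduces T.rules t (stateTerm ar q) := by
  induction t generalizing q with
  | var x => exact h.elim
  | app g ts ih =>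
    rcases g with f | p
    · obtain ⟨as, a, hmove, has, ha⟩ := h
      exact (Reduces.app (ar := stateRank ar Q) (f := Sum.inl f) fun i => ih i (has i)).trans
        (ReflTransGen.head (step_of_move hmove) (reduces_of_reflTransGen_eps ha))
    · obtain rfl : ts = Fin.elim0 := funext fun i => Fin.elim0 i
      exact reduces_of_reflTransGen_eps h

theorem reduces_iff_eval {t : Term (stateRank ar Q)} {q : Q} :
    Reduces T.rules t (stateTerm ar q) ↔ T.Eval t q := by
  refine ⟨fun h => ?_, Eval.reduces⟩
  induction h using ReflTransGen.head_induction_on with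
  | refl => exact ReflTransGen.refl
  | head h _ ih => exact ih.of_step h

theorem reduces_lift_iff_run {t : Term ar} {q : Q} :
    Reduces T.rules (t.lift Q) (stateTerm ar q) ↔ T.Run ⊥ t q := by
  rw [reduces_iff_eval]
  induction t generalizing q with
  | var x => rfl
  | app f ts ih => simp only [Run, ← ih]; rfl

theorem reduces_lift_subst_iff_run {t : Term ar} {e : ℕ → Q} {q : Q} :
    Reduces T.rules ((t.lift Q).subst fun x => stateTerm ar (e x)) (stateTerm ar q) ↔
      T.Run (fun x => ReflTransGen T.eps (e x)) t q := by
  rw [reduces_iff_eval]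
  induction t generalizing q with
  | var x => rfl
  | app f ts ih => simp only [Run, ← ih]; rfl

/-- All transitions are over the alphabet `Sg` and the set `G` of states. -/
structure SupportedOn (T : Transitions ar Q) (Sg : Set F) (G : Set Q) : Prop where
  move : ∀ f as a, T.move f as a → f ∈ Sg ∧ (∀ i, as i ∈ G) ∧ a ∈ G
  eps : ∀ a b, T.eps a b → a ∈ G ∧ b ∈ G

variable {Sg : Set F} {G : Set Q}

theorem exists_finite_rules_subset (hSg : Sg.Finite) (hG : G.Finite) :
    ∃ B : Set (Term (stateRank ar Q) × Term (stateRank ar Q)), B.Finite ∧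
      ∀ T : Transitions ar Q, T.SupportedOn Sg G → T.rules ⊆ B := by
  have hmove : (⋃ f ∈ Sg, Set.image2 (symbolRule ar f) {as | ∀ i, as i ∈ G} G).Finite :=
    hSg.biUnion fun f _ => (Set.Finite.pi' fun _ => hG).image2 _ hG
  refine ⟨_, hmove.union (hG.image2 (lambdaRule ar) hG), fun T hT => ?_⟩
  rintro ρ (⟨f, as, a, h, rfl⟩ | ⟨a, b, h, rfl⟩)
  · obtain ⟨hf, has, ha⟩ := hT.move f as a h
    exact Or.inl (Set.mem_biUnion hf ⟨as, has, a, ha, rfl⟩)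
  · exact Or.inr ⟨a, (hT.eps a b h).1, b, (hT.eps a b h).2, rfl⟩

theorem SupportedOn.isBTA (hT : T.SupportedOn Sg G) (hSg : Sg.Finite) (hG : G.Finite)
    {final : Set Q} (hfinal : final ⊆ G) : (TreeAutomaton.mk G T.rules final).IsBTA Sg := by
  obtain ⟨B, hB, hsub⟩ := exists_finite_rules_subset (ar := ar) hSg hG
  refine ⟨hG, hB.subset (hsub T hT), hfinal, ?_⟩
  rintro ρ (⟨f, as, a, h, rfl⟩ | ⟨a, b, h, rfl⟩)
  · obtain ⟨hf, has, ha⟩ := hT.move f as a h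
    exact Or.inl ⟨f, hf, as, a, has, ha, rfl⟩
  · exact Or.inr ⟨a, (hT.eps a b h).1, b, (hT.eps a b h).2, rfl⟩

/-- The transitions between the images of the states under `φ`. -/
def map {Q' : Type} (φ : Q → Q') (T : Transitions ar Q) : Transitions ar Q' where
  move f as' a' := ∃ as a, T.move f as a ∧ as' = φ ∘ as ∧ a' = φ a
  eps a' b' := ∃ a b, T.eps a b ∧ a' = φ a ∧ b' = φ b

variable {Q' : Type} {φ : Q → Q'}

theorem SupportedOn.map (hT : T.SupportedOn Sg G) : (T.map φ).SupportedOn Sg (φ '' G) where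
  move := by
    rintro f _ _ ⟨as, a, h, rfl, rfl⟩
    obtain ⟨hf, has, ha⟩ := hT.move f as a h
    exact ⟨hf, fun i => ⟨as i, has i, rfl⟩, a, ha, rfl⟩
  eps := by
    rintro _ _ ⟨a, b, h, rfl, rfl⟩
    exact ⟨⟨a, (hT.eps a b h).1, rfl⟩, b, (hT.eps a b h).2, rfl⟩

theorem reflTransGen_eps_map_iff (hT : T.SupportedOn Sg G) (hφ : G.InjOn φ) {a : Q} (ha : a ∈ G)
    {q' : Q'} : ReflTransGen (T.map φ).eps (φ a) q' ↔
      ∃ q ∈ G, q' = φ q ∧ ReflTransGen T.eps a q := by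
  constructor
  · intro h
    induction h with
    | refl => exact ⟨a, ha, rfl, ReflTransGen.refl⟩
    | tail _ h ih =>
      obtain ⟨q, hq, rfl, haq⟩ := ih
      obtain ⟨b, c, hbc, hqb, rfl⟩ := h
      obtain ⟨hb, hc⟩ := hT.eps b c hbc
      obtain rfl := hφ hq hb hqb
      exact ⟨c, hc, rfl, haq.tail hbc⟩
  · rintro ⟨q, -, rfl, h⟩
    exact ReflTransGen.lift φ (fun a b hab => ⟨a, b, hab, rfl, rfl⟩) _ _ h

theorem run_map_iff_exists (hT : T.SupportedOn Sg G) (hφ : G.InjOn φ) {t : Term ar} {q' : Q'} :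
    (T.map φ).Run ⊥ t q' ↔ ∃ q ∈ G, q' = φ q ∧ T.Run ⊥ t q := by
  induction t generalizing q' with
  | var x => exact ⟨fun h => h.elim, fun ⟨_, _, _, h⟩ => h⟩
  | app f ts ih =>
    constructor
    · rintro ⟨_, _, ⟨as, a, hmove, rfl, rfl⟩, hrun, ha'⟩
      obtain ⟨-, has, ha⟩ := hT.move f as a hmove
      obtain ⟨q, hq, rfl, haq⟩ := (reflTransGen_eps_map_iff hT hφ ha).1 ha'
      refine ⟨q, hq, rfl, as, a, hmove, fun i => ?_, haq⟩
      obtain ⟨b, hb, hab, hrunb⟩ := (ih i).1 (hrun i)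
      rwa [hφ (has i) hb hab]
    · rintro ⟨q, hq, rfl, as, a, hmove, hrun, haq⟩
      obtain ⟨-, has, ha⟩ := hT.move f as a hmove
      exact ⟨φ ∘ as, φ a, ⟨as, a, hmove, rfl, rfl⟩,
        fun i => (ih i).2 ⟨as i, has i, rfl, hrun i⟩,
        (reflTransGen_eps_map_iff hT hφ ha).2 ⟨q, hq, rfl, haq⟩⟩

theorem run_map_iff (hT : T.SupportedOn Sg G) (hφ : G.InjOn φ) {t : Term ar} {q : Q} (hq : q ∈ G) :
    (T.map φ).Run ⊥ t (φ q) ↔ T.Run ⊥ t q := by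
  rw [run_map_iff_exists hT hφ]
  exact ⟨fun ⟨_, hp, hqp, h⟩ => hφ hq hp hqp ▸ h, fun h => ⟨q, hq, rfl, h⟩⟩

end Transitions

/-! ## Saturated automata -/

/-- The tree automaton that evaluates a term to itself as long as its subterms belong to the set `X`
of states, with the additional state changes `eps`. -/
def evalTransitions {F : Type} {ar : F → ℕ} (Sg : Set F) (X : Set (Term ar))
    (eps : Term ar → Term ar → Prop) : Transitions ar (Term ar) where
  move f ps a := f ∈ Sg ∧ (∀ i, ps i ∈ X) ∧ Term.app f ps ∈ X ∧ a = Term.app f ps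
  eps := eps

namespace TRS

open Term Relation Transitions

variable {F : Type} {ar : F → ℕ} {R : TRS ar} {L : Set (Term ar)} {Sg : Set F}
  {eps : Term ar → Term ar → Prop}

/-- The state changes that one round of the saturation procedure adds to the state changes `eps`. -/
def SatStep (R : TRS ar) (Sg : Set F) (L : Set (Term ar)) (eps : Term ar → Term ar → Prop)
    (a b : Term ar) : Prop :=
  ∃ l r e, (l, r) ∈ R.rules ∧ (∀ x ∈ l.vars, e x ∈ R.values L) ∧ b ∈ R.setD L ∧
    (evalTransitions Sg (R.setD L) eps).Run (fun x => ReflTransGen eps (e x)) l b ∧ a = r.subst e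

/-- The invariant of the saturation procedure. The trivial state changes from a state to itself,
which the procedure need not produce, are admitted. -/
structure IsSound (R : TRS ar) (L : Set (Term ar)) (eps : Term ar → Term ar → Prop) : Prop where
  target_mem : ∀ {a b}, eps a b → b ∈ R.setD L
  source : ∀ {a b}, eps a b → a = b ∨ a ∈ R.rhsInstances L
  reduces : ∀ {a b}, eps a b → Reduces R.rules b a

/-- The saturation procedure adds to the state changes `eps` only compositions of them. -/
structure IsSaturated (R : TRS ar) (Sg : Set F) (L : Set (Term ar))
    (eps : Term ar → Term ar → Prop) : Prop extends R.IsSound L eps where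
  closed : ∀ {a b}, R.SatStep Sg L eps a b → ReflTransGen eps a b

namespace IsSound

theorem supportedOn (h : R.IsSound L eps) (Sg : Set F) :
    (evalTransitions Sg (R.setD L) eps).SupportedOn Sg (R.setD L) where
  move := by
    rintro f ps a ⟨hf, hps, ha, rfl⟩
    exact ⟨hf, hps, ha⟩
  eps a b hab := ⟨(h.source hab).elim (fun hab' => hab' ▸ h.target_mem hab)
    fun ha => rhsInstances_subset_setD ha, h.target_mem hab⟩

variable {a b : Term ar}

theorem target_mem_of_reflTransGen (h : R.IsSound L eps) (ha : a ∈ R.setD L)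
    (hab : ReflTransGen eps a b) : b ∈ R.setD L := by
  rcases hab.cases_tail with rfl | ⟨c, -, hcb⟩
  · exact ha
  · exact h.target_mem hcb

theorem source_of_reflTransGen (h : R.IsSound L eps) (hab : ReflTransGen eps a b) :
    a = b ∨ a ∈ R.rhsInstances L := by
  induction hab using ReflTransGen.head_induction_on with
  | refl => exact Or.inl rfl
  | head hac _ ih =>
    rcases h.source hac with rfl | ha
    · exact ih
    · exact Or.inr ha

theorem reduces_of_reflTransGen (h : R.IsSound L eps) (hab : ReflTransGen eps a b) :
    Reduces R.rules b a := by
  induction hab with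
  | refl => exact ReflTransGen.refl
  | tail _ hbc ih => exact (h.reduces hbc).trans ih

theorem reduces_of_run (h : R.IsSound L eps) {X : Set (Term ar)} {V : ℕ → Term ar → Prop}
    {θ : ℕ → Term ar} (hV : ∀ x q, V x q → Reduces R.rules q (θ x)) {t q : Term ar}
    (hq : (evalTransitions Sg X eps).Run V t q) : Reduces R.rules q (t.subst θ) := by
  induction t generalizing q with
  | var x => exact hV x q hq
  | app f ts ih =>
    obtain ⟨as, _, ⟨-, -, -, rfl⟩, has, ha⟩ := hq
    exact (h.reduces_of_reflTransGen ha).trans (Reduces.app fun i => ih i (has i))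

theorem mem_setD_of_run (h : R.IsSound L eps) {V : ℕ → Term ar → Prop} {t q : Term ar}
    (ht : ¬ t.IsVar) (hq : (evalTransitions Sg (R.setD L) eps).Run V t q) : q ∈ R.setD L := by
  cases t with
  | var x => exact absurd ⟨x, rfl⟩ ht
  | app f ts =>
    obtain ⟨_, _, ⟨-, -, ha, rfl⟩, -, haq⟩ := hq
    exact h.target_mem_of_reflTransGen ha haq

theorem sup {eps' : Term ar → Term ar → Prop} (h : R.IsSound L eps) (h' : R.IsSound L eps') :
    R.IsSound L (eps ⊔ eps') where
  target_mem := Or.rec h.target_mem h'.target_mem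
  source := Or.rec h.source h'.source
  reduces := Or.rec h.reduces h'.reduces

theorem satStep (h : R.IsSound L eps) (Sg : Set F) : R.IsSound L (R.SatStep Sg L eps) where
  target_mem := fun ⟨_, _, _, _, _, hb, _, _⟩ => hb
  source := fun ⟨_, _, _, hlr, he, _, _, ha⟩ => Or.inr (ha ▸ subst_mem_rhsInstances hlr he)
  reduces := by
    rintro _ _ ⟨l, r, e, hlr, -, -, hrun, rfl⟩
    have hl : Reduces R.rules _ (l.subst e) :=
      h.reduces_of_run (θ := e) (fun _ _ => h.reduces_of_reflTransGen) hrun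
    exact hl.tail (Step.root l r e hlr)

end IsSound

theorem exists_overlap {l₁ r₁ l r u v K : Term ar} {α β : List ℕ} {e : ℕ → Term ar}
    (h₁ : (l₁, r₁) ∈ R.rules) (h : (l, r) ∈ R.rules) (hu : r₁.subAt α = some u)
    (hv : l.subAt β = some v) (hαβ : α = [] ∨ β = []) (hKv : K.Fits v) (hKu : K.Fits (u.subst e)) :
    ∃ K' σ τ, K'.shape = K.shape ∧ R.Overlap l β K' σ ∧ u.subst σ = K'.subst σ ∧
      (∀ x ∈ u.vars, e x = (σ x).subst τ) ∧ (K'.subst fun x => (σ x).subst τ) = u.subst e := by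
  obtain ⟨K', hlin, hdisj, hshape⟩ := exists_linear_variant K l₁.finite_vars
  have hfit : K'.Fits K := fits_of_shape_eq hshape
  obtain ⟨ρ, hρ, -⟩ := hlin.exists_subst_eq (hfit.trans hKv) var
  obtain ⟨θ, hθ, hθe⟩ := hlin.exists_subst_eq (hfit.trans hKu) e
  have hul : u.vars ⊆ l₁.vars := (vars_subset_of_mem_sub ⟨α, hu⟩).trans (R.vars_subset _ _ h₁)
  replace hθe : ∀ x ∈ u.vars, θ x = e x := fun x hx =>
    hθe x fun hK => Set.disjoint_left.1 hdisj hK (hul hx)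
  have huK : u.subst θ = K'.subst θ := (subst_congr hθe).trans hθ.symm
  obtain ⟨σ, hσ⟩ := exists_isMGU huK
  obtain ⟨τ, hτ⟩ := hσ.2 θ huK
  refine ⟨K', σ, τ, hshape, ⟨l₁, r₁, r, h₁, h, α, u, v, hu, hv, hαβ, ⟨hlin, ρ, hρ.symm⟩, hdisj, hσ⟩,
    hσ.1, fun x hx => (hθe x hx).symm.trans (hτ x), ?_⟩
  rw [← hθ, ← funext hτ]

theorem IsGSM.mem_values (hgsm : R.IsGSM) {l₁ r₁ l r u v K w : Term ar} {α β γ : List ℕ}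
    {e : ℕ → Term ar} {x y : ℕ} (h₁ : (l₁, r₁) ∈ R.rules) (h : (l, r) ∈ R.rules)
    (hu : r₁.subAt α = some u) (hv : l.subAt β = some v) (hαβ : α = [] ∨ β = [])
    (hvar : ¬ v.IsVar) (hKv : K.Fits v) (hKu : K.Fits (u.subst e))
    (he : ∀ x ∈ u.vars, e x ∈ R.values L) (hγK : K.subAt γ = some (var y))
    (hγv : v.subAt γ = some (var x)) (hγw : (u.subst e).subAt γ = some w) : w ∈ R.values L := by
  obtain ⟨K', σ, τ, hshape, hov, hσ, hστ, hK'⟩ := exists_overlap h₁ h hu hv hαβ hKv hKu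
  obtain ⟨z, hz⟩ := exists_subAt_eq_var_of_shape_eq hshape.symm hγK
  have hw : (σ z).subst τ = w := Option.some.inj ((subAt_subst hz _).symm.trans (hK' ▸ hγw))
  have hlγ : ∃ x, l.subAt (β ++ γ) = some (var x) := ⟨x, by rw [subAt_append hv, hγv]⟩
  rcases hgsm.2 l β K' σ hov with ⟨x, hx⟩ | hcase
  · exact absurd ⟨x, Option.some.inj (hv.symm.trans hx)⟩ hvar
  rcases hcase γ _ hz hlγ with ⟨y', hy'⟩ | hground
  · have hmem : y' ∈ (u.subst σ).vars := by
      rw [hσ]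
      exact mem_vars_subst.2 ⟨z, ⟨γ, hz⟩, by rw [← subst_var σ z, hy']; exact self_mem_sub _⟩
    obtain ⟨x', hx', hy⟩ := mem_vars_subst.1 hmem
    refine mem_values_of_mem_sub (he x' hx') ?_
    rw [hστ x' hx', ← hw, ← subst_var σ z, hy']
    exact subst_mem_sub_subst hy τ
  · rw [← hw, ← subst_var σ z, hground.subst_eq]
    refine subset_subLang _ (Or.inr ⟨hground, l, β, K', σ, hov, ?_, γ, _, hz, hlγ, rfl⟩)
    rintro ⟨x', rfl⟩
    cases γ with
    | nil => exact hvar ⟨x, by simpa using hγv⟩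
    | cons i γ => simp at hz

/-- `K` is a common part of `v` and of a state `d` to which a run evaluates `v`, large enough to
determine the values `s x` of the variables of `v`, except for some that belong to `A`. -/
def IsSharedPart (A : Set (Term ar)) (s : ℕ → Term ar) (K v d : Term ar) : Prop :=
  K.Fits v ∧ K.Fits d ∧ ∀ γ x, v.subAt γ = some (var x) →
    s x ∈ A ∨ (∃ y, K.subAt γ = some (var y)) ∧ d.subAt γ = some (s x)

theorem isSharedPart_app {A : Set (Term ar)} {s : ℕ → Term ar} {f : F}
    {Ks vs ds : Fin (ar f) → Term ar} (h : ∀ i, IsSharedPart A s (Ks i) (vs i) (ds i)) :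
    IsSharedPart A s (app f Ks) (app f vs) (app f ds) := by
  refine ⟨fits_app.2 fun i => (h i).1, fits_app.2 fun i => (h i).2.1, fun γ x hγ => ?_⟩
  cases γ with
  | nil => simp at hγ
  | cons i γ =>
    obtain ⟨j, rfl, hj⟩ := subAt_app_cons_eq_some hγ
    simpa using (h j).2.2 γ x hj

namespace IsSound

theorem exists_isSharedPart (hs : R.IsSound L eps) (hgsm : R.IsGSM) {l r : Term ar}
    (h : (l, r) ∈ R.rules) {s : ℕ → Term ar} {v d : Term ar} (hv : v ∈ l.sub)
    (hd : (evalTransitions Sg (R.setD L) eps).Run (fun x q => q = s x) v d) :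
    ∃ K, IsSharedPart (R.values L) s K v d := by
  induction v generalizing d with
  | var x =>
    refine ⟨var 0, trivial, trivial, fun γ y hγ => Or.inr ?_⟩
    cases γ with
    | nil => simp_all [Run]
    | cons i γ => simp at hγ
  | app f vs ih =>
    obtain ⟨ps, _, ⟨-, -, -, rfl⟩, hps, hpd⟩ := hd
    choose Ks hKs using fun i => ih i (sub_trans (arg_mem_sub f vs i) hv) (hps i)
    have hK := isSharedPart_app hKs
    rcases hs.source_of_reflTransGen hpd with rfl | hinst
    · exact ⟨_, hK⟩
    -- The state was changed at an instance of a right-hand side: overlap it at its root with `v`.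
    obtain ⟨⟨l₁, r₁⟩, h₁, e, he, hpe⟩ := Set.mem_iUnion₂.1 hinst
    obtain ⟨β, hβ⟩ := hv
    refine ⟨var 0, trivial, trivial, fun γ x hγ => Or.inl ?_⟩
    rcases hK.2.2 γ x hγ with hA | ⟨⟨y, hy⟩, hγd⟩
    · exact hA
    · exact hgsm.mem_values h₁ h (subAt_nil r₁) hβ (Or.inl rfl) (fun ⟨_, h⟩ => nomatch h) hK.1
        (hpe ▸ hK.2.1) he hy hγ (hpe ▸ hγd)

theorem mem_values_of_run (hs : R.IsSound L eps) (hgsm : R.IsGSM) {l r : Term ar}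
    (h : (l, r) ∈ R.rules) {s : ℕ → Term ar} {q : Term ar}
    (hq : (evalTransitions Sg (R.setD L) eps).Run (fun x q => q = s x) l q) :
    ∀ x ∈ l.vars, s x ∈ R.values L := by
  rintro x ⟨γ, hγ⟩
  obtain ⟨K, hKl, hKq, hK⟩ := hs.exists_isSharedPart hgsm h (self_mem_sub l) hq
  rcases hK γ x hγ with hA | ⟨⟨y, hy⟩, hγq⟩
  · exact hA
  rcases mem_setD_iff.1 (hs.mem_setD_of_run (hgsm.1 l r h) hq) with
    hL | ⟨⟨l₁, r₁⟩, h₁, p, ⟨α, hα⟩, e, he, rfl⟩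
  · exact mem_values_of_mem_sub (subLang_mono Set.subset_union_left hL) ⟨γ, hγq⟩
  · exact hgsm.mem_values h₁ h hα (subAt_nil l) (Or.inr rfl) (hgsm.1 l r h) hKl hKq he hy hγ hγq

end IsSound

theorem run_rhs (hSg : R.sign ⊆ Sg) {l r : Term ar} (h : (l, r) ∈ R.rules)
    {V : ℕ → Term ar → Prop} {s : ℕ → Term ar} (hV : ∀ x ∈ r.vars, V x (s x))
    (hs : ∀ x ∈ r.vars, s x ∈ R.values L) :
    (evalTransitions Sg (R.setD L) eps).Run V r (r.subst s) := by
  have hD : r.subst s ∈ R.setD L :=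
    mem_setD_iff.2 (Or.inr ⟨(l, r), h, r, self_mem_sub r, s, hs, rfl⟩)
  have hsign : r.symbols ⊆ Sg := fun f hf => hSg ⟨l, r, h, Or.inr hf⟩
  clear h hs
  induction r with
  | var x => exact hV x (self_mem_sub _)
  | app f ts ih =>
    have hDi (i : Fin (ar f)) : (ts i).subst s ∈ R.setD L :=
      mem_setD_of_mem_sub hD (arg_mem_sub f _ i)
    refine ⟨fun i => (ts i).subst s, _, ⟨hsign (mem_symbols_app.2 (Or.inl rfl)), hDi, hD, rfl⟩,
      fun i => ih i (fun x hx => hV x (mem_vars_app.2 ⟨i, hx⟩)) (hDi i) ?_, ReflTransGen.refl⟩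
    exact (symbols_subset_of_mem_sub (arg_mem_sub f ts i)).trans hsign

theorem run_self {t : Term ar} (ht : t ∈ groundTerms ar Sg) (hD : t ∈ R.setD L) :
    (evalTransitions Sg (R.setD L) eps).Run ⊥ t t := by
  induction t with
  | var x => exact absurd ht.1 (not_isGround_var x)
  | app f ts ih =>
    obtain ⟨hf, hts⟩ := app_mem_groundTerms.1 ht
    have hDi (i : Fin (ar f)) : ts i ∈ R.setD L := mem_setD_of_mem_sub hD (arg_mem_sub f ts i)
    exact ⟨ts, _, ⟨hf, hDi, hD, rfl⟩, fun i => ih i (hts i) (hDi i), ReflTransGen.refl⟩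

namespace IsSaturated

theorem run_of_step (hs : R.IsSaturated Sg L eps) (hSg : R.sign ⊆ Sg) (hlin : R.LeftLinear)
    (hgsm : R.IsGSM) {t t' : Term ar} (h : Step R.rules t t') {q : Term ar}
    (hq : (evalTransitions Sg (R.setD L) eps).Run ⊥ t q) :
    (evalTransitions Sg (R.setD L) eps).Run ⊥ t' q := by
  induction h generalizing q with
  | root l r θ hlr =>
    obtain ⟨s, hsθ, hrun⟩ := (run_subst.1 hq).exists_valuation (hlin l r hlr)
    have hsA := hs.mem_values_of_run hgsm hlr hrun
    have hvars := R.vars_subset l r hlr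
    have hrhs := run_rhs (eps := eps) hSg hlr (fun x hx => hsθ x (hvars hx))
      fun x hx => hsA x (hvars hx)
    refine (run_subst.2 hrhs).trans (fun _ _ _ h => h.elim) (hs.closed ⟨l, r, s, hlr, hsA,
      hs.mem_setD_of_run (hgsm.1 l r hlr) hrun, hrun.mono fun x _ q hq => ?_, rfl⟩)
    exact hq ▸ ReflTransGen.refl
  | arg f ts i s _ ih =>
    obtain ⟨as, a, hmove, has, ha⟩ := hq
    exact ⟨as, a, hmove, (Function.forall_update_iff ts fun j u => Run _ ⊥ u (as j)).2
      ⟨ih (has i), fun j _ => has j⟩, ha⟩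

theorem run_iff_reduces (hs : R.IsSaturated Sg L eps) (hSg : R.sign ⊆ Sg) (hlin : R.LeftLinear)
    (hgsm : R.IsGSM) {p t : Term ar} (hp : p ∈ groundTerms ar Sg) (hD : p ∈ R.setD L)
    (ht : t.IsGround) :
    (evalTransitions Sg (R.setD L) eps).Run ⊥ t p ↔ Reduces R.rules p t := by
  constructor
  · intro h
    have := hs.reduces_of_run (θ := var) (fun _ _ h => h.elim) h
    rwa [ht.subst_eq] at this
  · intro h
    clear ht
    induction h with
    | refl => exact run_self hp hD
    | tail _ h ih => exact hs.run_of_step hSg hlin hgsm h ih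

end IsSaturated

end TRS

/-! ## The saturation procedure -/

namespace TRS

open Term Relation Transitions

variable {F : Type} {ar : F → ℕ} (R : TRS ar) (Sg : Set F) (L : Set (Term ar))

/-- The state changes that the first `i` rounds of the saturation procedure add. -/
def satEps : ℕ → Term ar → Term ar → Prop
  | 0 => ⊥
  | i + 1 => satEps i ⊔ R.SatStep Sg L (satEps i)

theorem satRules_eq (i : ℕ) :
    R.satRules Sg L i = (evalTransitions Sg (R.setD L) (R.satEps Sg L i)).rules := by
  induction i with
  | zero =>
    simp only [satRules, TreeAutomaton.fundamental, subLang_setD]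
    ext ρ
    constructor
    · rintro ⟨f, hf, ps, hps, ha, rfl⟩
      exact Or.inl ⟨f, ps, _, ⟨hf, hps, ha, rfl⟩, rfl⟩
    · rintro (⟨f, ps, _, ⟨hf, hps, ha, rfl⟩, rfl⟩ | ⟨a, b, h, -⟩)
      · exact ⟨f, hf, ps, hps, ha, rfl⟩
      · exact h.elim
  | succ i ih =>
    simp only [satRules, ih, TreeAutomaton.fundamental, subLang_setD, reduces_lift_subst_iff_run]
    ext ρ
    constructor
    · rintro ((h | ⟨a, b, h, rfl⟩) | ⟨l, r, e, c, hlr, he, hc, hrun, rfl⟩)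
      · exact Or.inl h
      · exact Or.inr ⟨a, b, Or.inl h, rfl⟩
      · exact Or.inr ⟨_, c, Or.inr ⟨l, r, e, hlr, he, hc, hrun, rfl⟩, rfl⟩
    · rintro (h | ⟨a, b, h | ⟨l, r, e, hlr, he, hb, hrun, rfl⟩, rfl⟩)
      · exact Or.inl (Or.inl h)
      · exact Or.inl (Or.inr ⟨a, b, h, rfl⟩)
      · exact Or.inr ⟨l, r, e, b, hlr, he, hb, hrun, rfl⟩

theorem isSound_satEps (i : ℕ) : R.IsSound L (R.satEps Sg L i) := by
  induction i with
  | zero => exact ⟨fun h => h.elim, fun h => h.elim, fun h => h.elim⟩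
  | succ i ih => exact ih.sup (ih.satStep Sg)

variable {Sg L}

theorem isSaturated_satEps {i : ℕ} (hi : R.satRules Sg L i = R.satRules Sg L (i + 1)) :
    R.IsSaturated Sg L (R.satEps Sg L i) where
  toIsSound := R.isSound_satEps Sg L i
  closed h := by
    let T := evalTransitions Sg (R.setD L) (R.satEps Sg L i)
    refine ReflTransGen.single (lambdaRule_mem_rules (T := T).1 ?_)
    rw [← satRules_eq, hi, satRules_eq]
    exact lambdaRule_mem_rules.2 (Or.inr h)

theorem exists_satRules_eq (hSg : Sg.Finite) (hL : L.Finite) :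
    ∃ i, R.satRules Sg L i = R.satRules Sg L (i + 1) := by
  obtain ⟨B, hB, hsub⟩ := exists_finite_rules_subset (ar := ar) hSg (R.finite_setD hL)
  by_contra! hne
  have hmono : StrictMono (R.satRules Sg L) := strictMono_nat_of_lt_succ fun i =>
    lt_of_le_of_ne Set.subset_union_left (hne i)
  refine Set.infinite_of_injective_forall_mem hmono.injective (fun i => ?_) hB.powerset
  exact R.satRules_eq Sg L i ▸ hsub _ ((R.isSound_satEps Sg L i).supportedOn Sg)

theorem satAutomaton_eq (i : ℕ) : R.satAutomaton Sg L i =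
    ⟨R.setD L, (evalTransitions Sg (R.setD L) (R.satEps Sg L i)).rules, L⟩ := by
  simp only [satAutomaton, TreeAutomaton.fundamental, subLang_setD, satRules_eq]

theorem satAutomaton_isBTA (hSg : Sg.Finite) (hL : L.Finite) (i : ℕ) :
    (R.satAutomaton Sg L i).IsBTA Sg :=
  R.satAutomaton_eq i ▸
    ((R.isSound_satEps Sg L i).supportedOn Sg).isBTA hSg (R.finite_setD hL) subset_setD

theorem satAutomaton_language (hlin : R.LeftLinear) (hgsm : R.IsGSM) (hSg : R.sign ⊆ Sg)
    (hL : L ⊆ groundTerms ar Sg) {i : ℕ} (hi : R.satRules Sg L i = R.satRules Sg L (i + 1)) :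
    (R.satAutomaton Sg L i).language Sg = R.descendants L := by
  rw [satAutomaton_eq]
  refine TreeAutomaton.language_eq_descendants hSg hL (φ := id) (Set.image_id L).symm
    fun p hp t ht => reduces_lift_iff_run.trans ?_
  exact (R.isSaturated_satEps hi).run_iff_reduces hSg hlin hgsm (hL hp) (subset_setD hp) ht

end TRS

/-! ## Terms as words -/

namespace Term

variable {F : Type} {ar : F → ℕ}

/-- One step of the parsing of a word from the right. The words of the arguments of `f` are the
topmost words of the stack `p.1` and are replaced by the word of the term with the root `f`, which
is also recorded in the list `p.2`. -/
def parseSymbol (ar : F → ℕ) (f : F) (p : List (List F) × List (List F)) :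
    List (List F) × List (List F) :=
  ((f :: (p.1.take (ar f)).flatten) :: p.1.drop (ar f), (f :: (p.1.take (ar f)).flatten) :: p.2)

/-- The parsing of the concatenation of the words of some ground terms. It yields the list of the
words of these terms and the list of the words of all their subterms. -/
def parse (ar : F → ℕ) (w : List F) : List (List F) × List (List F) :=
  w.foldr (parseSymbol ar) ([], [])

/-- The words of the arguments of the root of the term with the word `w`. -/
def argWords (ar : F → ℕ) (w : List F) : List (List F) := (parse ar w.tail).1

/-- The words of the subterms of the term with the word `w`. -/
def subWords (ar : F → ℕ) (w : List F) : List (List F) := (parse ar w).2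

theorem word_app (f : F) (ts : Fin (ar f) → Term ar) :
    (app f ts).word = f :: ((List.ofFn ts).map word).flatten := by
  simp only [word, List.map_ofFn, Function.comp_def]

theorem foldr_parseSymbol_flatten {ts : List (Term ar)}
    (h : ∀ t ∈ ts, ∀ p, ∃ c, t.word.foldr (parseSymbol ar) p = (t.word :: p.1, c) ∧
      ∀ w, w ∈ c ↔ w ∈ p.2 ∨ w ∈ word '' t.sub) (p : List (List F) × List (List F)) :
    ∃ c, (ts.map word).flatten.foldr (parseSymbol ar) p = (ts.map word ++ p.1, c) ∧
      ∀ w, w ∈ c ↔ w ∈ p.2 ∨ ∃ t ∈ ts, w ∈ word '' t.sub := by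
  induction ts with
  | nil => exact ⟨p.2, rfl, by simp⟩
  | cons t ts ih =>
    obtain ⟨c, hc, hcw⟩ := ih fun t ht => h t (List.mem_cons_of_mem _ ht)
    obtain ⟨c', hc', hcw'⟩ := h t List.mem_cons_self (ts.map word ++ p.1, c)
    refine ⟨c', by simp [List.foldr_append, hc, hc'], fun w => ?_⟩
    rw [hcw', hcw]
    simp only [List.mem_cons, exists_eq_or_imp]
    rw [or_assoc, or_comm (a := ∃ t ∈ ts, _)]

theorem IsGround.foldr_parseSymbol_word {t : Term ar} (ht : t.IsGround)
    (p : List (List F) × List (List F)) :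
    ∃ c, t.word.foldr (parseSymbol ar) p = (t.word :: p.1, c) ∧
      ∀ w, w ∈ c ↔ w ∈ p.2 ∨ w ∈ word '' t.sub := by
  induction t generalizing p with
  | var x => exact absurd ht (not_isGround_var x)
  | app f ts ih =>
    obtain ⟨c, hc, hcw⟩ := foldr_parseSymbol_flatten (ts := List.ofFn ts)
      (List.forall_mem_ofFn_iff.2 fun i => ih i (isGround_app.1 ht i)) p
    have hlen : ((List.ofFn ts).map word).length = ar f := by simp
    refine ⟨(app f ts).word :: c, ?_, fun w => ?_⟩
    · rw [word_app, List.foldr_cons, hc]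
      simp only [parseSymbol, List.take_left' hlen, List.drop_left' hlen]
    · have hsub : w ∈ word '' (app f ts).sub ↔
          w = (app f ts).word ∨ ∃ t ∈ List.ofFn ts, w ∈ word '' t.sub := by
        simp only [Set.mem_image, mem_sub_app, List.mem_ofFn]
        grind
      rw [List.mem_cons, hcw, hsub, or_left_comm]

theorem IsGround.mem_subWords_word {t : Term ar} (ht : t.IsGround) {w : List F} :
    w ∈ subWords ar t.word ↔ w ∈ word '' t.sub := by
  obtain ⟨c, hc, hcw⟩ := ht.foldr_parseSymbol_word ([], [])
  simp [subWords, parse, hc, hcw]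

theorem IsGround.argWords_word {f : F} {ts : Fin (ar f) → Term ar} (ht : (app f ts).IsGround) :
    argWords ar (app f ts).word = List.ofFn fun i => (ts i).word := by
  obtain ⟨c, hc, -⟩ := foldr_parseSymbol_flatten (ts := List.ofFn ts)
    (List.forall_mem_ofFn_iff.2 fun i => (isGround_app.1 ht i).foldr_parseSymbol_word) ([], [])
  rw [argWords, word_app, List.tail_cons, parse, hc, List.append_nil, List.map_ofFn]
  rfl

theorem word_injOn : Set.InjOn (word (ar := ar)) {t | t.IsGround} := by
  intro s hs t ht h
  induction s generalizing t with
  | var x => exact absurd hs (not_isGround_var x)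
  | app f ss ih =>
    cases t with
    | var y => exact absurd ht (not_isGround_var y)
    | app g ts =>
      obtain rfl : f = g := (List.cons.inj h).1
      have hargs : (fun i => (ss i).word) = fun i => (ts i).word := by
        apply List.ofFn_injective
        rw [← IsGround.argWords_word hs, ← IsGround.argWords_word ht, h]
      exact congrArg (app f)
        (funext fun i => ih i (isGround_app.1 hs i) (isGround_app.1 ht i) (congrFun hargs i))

/-- The word of the instance of a term, if `ε` lists the words of the values of the variables. -/
def instWord (ε : List (List F)) : Term ar → List F
  | var x => ε.getD x []
  | app f ts => f :: (List.ofFn fun i => instWord ε (ts i)).flatten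

theorem word_subst {p : Term ar} {e : ℕ → Term ar} {ε : List (List F)}
    (h : ∀ x ∈ p.vars, ε.getD x [] = (e x).word) : (p.subst e).word = p.instWord ε := by
  induction p with
  | var x => exact (h x (by simp)).symm
  | app f ts ih =>
    simp only [subst_app, word, instWord]
    congr 3
    exact funext fun i => ih i fun x hx => h x (mem_vars_app.2 ⟨i, hx⟩)

/-- The least number that exceeds all variables of a term. -/
def varBound : Term ar → ℕ
  | var x => x + 1
  | app _ ts => Finset.univ.sup fun i => varBound (ts i)

theorem lt_varBound {p : Term ar} {x : ℕ} (hx : x ∈ p.vars) : x < p.varBound := by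
  induction p with
  | var y => exact mem_vars_var.1 hx ▸ Nat.lt_succ_self x
  | app f ts ih =>
    obtain ⟨i, hi⟩ := mem_vars_app.1 hx
    exact (ih i hi).trans_le (Finset.le_sup (f := fun i => varBound (ts i)) (Finset.mem_univ i))

theorem IsGround.varBound_eq_zero {p : Term ar} (hp : p.IsGround) : p.varBound = 0 := by
  induction p with
  | var y => exact absurd hp (not_isGround_var y)
  | app f ts ih =>
    exact Nat.le_zero.1 (Finset.sup_le fun i _ => (ih i (isGround_app.1 hp i)).le)

end Term

/-- All lists of length `n` with elements from `A`. -/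
def tuples {α : Type*} (A : List α) : ℕ → List (List α)
  | 0 => [[]]
  | n + 1 => A.flatMap fun a => (tuples A n).map (List.cons a)

theorem mem_tuples {α : Type*} {A : List α} {n : ℕ} {ε : List α} :
    ε ∈ tuples A n ↔ ε.length = n ∧ ∀ a ∈ ε, a ∈ A := by
  induction n generalizing ε with
  | zero => simp +contextual [tuples]
  | succ n ih =>
    cases ε with
    | nil => simp [tuples]
    | cons a ε => simp [tuples, ih]; tauto

namespace Term

variable {F : Type} {ar : F → ℕ} {W : List (List F)} {A : Set (Term ar)}

theorem exists_subst_of_mem_tuples (hW : ∀ w ∈ W, w ∈ word '' A) {p : Term ar}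
    {ε : List (List F)} (hε : ε ∈ tuples W p.varBound) :
    ∃ e : ℕ → Term ar, ∀ x ∈ p.vars, e x ∈ A ∧ ε.getD x [] = (e x).word := by
  obtain ⟨hlen, hmem⟩ := mem_tuples.1 hε
  have hex (x : ℕ) : ∃ t : Term ar, x ∈ p.vars → t ∈ A ∧ ε.getD x [] = t.word := by
    by_cases hx : x < ε.length
    · obtain ⟨t, ht, htw⟩ := hW _ (hmem _ (List.getElem_mem hx))
      exact ⟨t, fun _ => ⟨ht, by rw [List.getD_eq_getElem _ _ hx, htw]⟩⟩
    · exact ⟨var 0, fun h => absurd (hlen ▸ lt_varBound h) hx⟩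
  choose e he using hex
  exact ⟨e, he⟩

theorem exists_mem_tuples (hW : ∀ t ∈ A, t.word ∈ W) {p : Term ar} {e : ℕ → Term ar}
    (he : ∀ x ∈ p.vars, e x ∈ A) :
    ∃ ε ∈ tuples W p.varBound, ∀ x ∈ p.vars, ε.getD x [] = (e x).word := by
  classical
  rcases p.vars.eq_empty_or_nonempty with hp | ⟨y, hy⟩
  · refine ⟨[], mem_tuples.2 ⟨(IsGround.varBound_eq_zero hp).symm, by simp⟩, ?_⟩
    simp [hp]
  refine ⟨(List.range p.varBound).map fun x => (e (if x ∈ p.vars then x else y)).word,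
    mem_tuples.2 ⟨by simp, List.forall_mem_map.2 fun x _ => hW _ (he _ ?_)⟩, fun x hx => ?_⟩
  · split_ifs with hx
    exacts [hx, hy]
  · simp [List.getD_eq_getElem?_getD, lt_varBound hx, hx]

theorem mem_map_instWord_tuples (hW : ∀ w, w ∈ W ↔ w ∈ word '' A) {p : Term ar} {w : List F} :
    (w ∈ (tuples W p.varBound).map fun ε => p.instWord ε) ↔ w ∈ word '' p.instances A := by
  constructor
  · intro hw
    obtain ⟨ε, hε, rfl⟩ := List.mem_map.1 hw
    obtain ⟨e, he⟩ := exists_subst_of_mem_tuples (fun w => (hW w).1) hε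
    exact ⟨p.subst e, ⟨e, fun x hx => (he x hx).1, rfl⟩, word_subst fun x hx => (he x hx).2⟩
  · rintro ⟨_, ⟨e, he, rfl⟩, rfl⟩
    obtain ⟨ε, hε, hεw⟩ := exists_mem_tuples (fun t ht => (hW _).2 ⟨t, ht, rfl⟩) he
    exact List.mem_map.2 ⟨ε, hε, (word_subst hεw).symm⟩

end Term

/-! ## Primitive recursion -/

theorem isFixedPt_iterate_nil {α : Type*} {g : List α → List α} {l : List α}
    (hsub : ∀ Λ, (g Λ).Sublist l) (hinfl : ∀ Λ : List α, Λ.Sublist l → Λ.Sublist (g Λ)) :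
    Function.IsFixedPt g (g^[l.length] []) := by
  have hsucc (n : ℕ) : g^[n + 1] [] = g (g^[n] []) := Function.iterate_succ_apply' g n []
  have hle (n : ℕ) : (g^[n] []).Sublist l := by
    cases n with
    | zero => exact List.nil_sublist l
    | succ n => exact hsucc n ▸ hsub _
  have hmono (n : ℕ) : (g^[n] []).Sublist (g^[n + 1] []) := hsucc n ▸ hinfl _ (hle n)
  have hlen : (g^[l.length] []).length = (g^[l.length + 1] []).length := by
    refine (Nat.stabilises_of_monotone (f := fun n => (g^[n] []).length)
      (monotone_nat_of_le_succ fun n => (hmono n).length_le) (fun n => (hle n).length_le)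
      (fun n hn => ?_) (Nat.le_succ _)).symm
    have hn' := (hmono n).eq_of_length hn
    simp only [hsucc (n + 1), ← hn', ← hsucc]
  exact (hsucc _).symm.trans ((hmono _).eq_of_length hlen).symm

section PrimrecPredicates

open Primrec

variable {α β : Type*} [Primcodable α] [Primcodable β]

theorem primrecPred_forall_fin {n : ℕ} {P : Fin n → α → Prop} (h : ∀ i, PrimrecPred (P i)) :
    PrimrecPred fun a => ∀ i, P i a := by
  induction n with
  | zero => exact (Primrec.eq.comp (Primrec.const 0) (Primrec.const 0)).of_eq fun a => by simp
  | succ n ih =>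
    exact ((h 0).and (ih fun i => h i.succ)).of_eq fun a =>
      (Fin.forall_fin_succ (P := fun i => P i a)).symm

theorem primrecRel_mem_list : PrimrecRel fun (a : α) (l : List α) => a ∈ l :=
  (PrimrecRel.exists_mem_list (R := fun a b : α => a = b) Primrec.eq).swap.of_eq
    fun a l => by simp

theorem primrecPred_exists_mem_const {T : Type*} (l : List T) {P : T → α → Prop}
    (h : ∀ t, PrimrecPred (P t)) : PrimrecPred fun a => ∃ t ∈ l, P t a := by
  induction l with
  | nil => exact (Primrec.eq.comp (Primrec.const 0) (Primrec.const 1)).of_eq fun a => by simp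
  | cons t l ih => exact ((h t).or ih).of_eq fun a => by simp

theorem primrec_flatMap_const {T : Type*} (l : List T) {f : T → α → List β}
    (h : ∀ t, Primrec (f t)) : Primrec fun a => l.flatMap fun t => f t a := by
  induction l with
  | nil => exact Primrec.const []
  | cons t l ih => exact (list_append.comp (h t) ih).of_eq fun a => by simp

theorem primrec_tuples (n : ℕ) : Primrec fun A : List α => tuples A n := by
  induction n with
  | zero => exact Primrec.const [[]]
  | succ n ih =>
    exact list_flatMap Primrec.id (list_map (ih.comp fst) (list_cons.comp (snd.comp fst) snd))

end PrimrecPredicates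

namespace Term

open Primrec

variable {F : Type} [Primcodable F] {ar : F → ℕ}

theorem primrec_parse (har : Primrec ar) : Primrec (parse ar) := by
  have hword : Primrec fun z : F × (List (List F) × List (List F)) =>
      z.1 :: (z.2.1.take (ar z.1)).flatten :=
    list_cons.comp fst (list_flatten.comp (list_take.comp (har.comp fst) (fst.comp snd)))
  have hsymbol : Primrec₂ (parseSymbol ar) :=
    Primrec.pair (list_cons.comp hword (list_drop.comp (har.comp fst) (fst.comp snd)))
      (list_cons.comp hword (snd.comp snd))
  exact list_foldr (h := fun _ z => parseSymbol ar z.1 z.2) Primrec.id (Primrec.const ([], []))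
    (hsymbol.comp (fst.comp snd) (snd.comp snd))

theorem primrec_argWords (har : Primrec ar) : Primrec (argWords ar) :=
  fst.comp ((primrec_parse har).comp list_tail)

theorem primrec_subWords (har : Primrec ar) : Primrec (subWords ar) :=
  snd.comp (primrec_parse har)

theorem primrec_instWord (p : Term ar) : Primrec fun ε : List (List F) => p.instWord ε := by
  induction p with
  | var x => exact (list_getD []).comp Primrec.id (Primrec.const x)
  | app f ts ih => exact list_cons.comp (Primrec.const f) (list_flatten.comp (list_ofFn ih))

end Term

/-! ## The saturation procedure on words -/

namespace TRS

open Term Relation Transitions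

section Definitions

variable {F : Type} {ar : F → ℕ}

/-- The version of `Transitions.Run` for words. The states of the automaton are given by the list
`W` of their words, the state changes by the list `Λ` of pairs of words, and the values of the
variables by `ε`. The list `Λ` is not closed under composition here. -/
def RunWord (Sg : List F) (W : List (List F)) (Λ : List (List F × List F)) (ε : List (List F)) :
    Term ar → List F → Prop
  | var x, q => (ε.getD x [], q) ∈ Λ
  | app f ts, q => f ∈ Sg ∧ ∃ w ∈ W, w.head? = some f ∧ (w, q) ∈ Λ ∧
      ∀ i, RunWord Sg W Λ ε (ts i) ((argWords ar w).getD i [])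

noncomputable section

variable (R : TRS ar)

theorem finite_rhsParts : (⋃ ρ ∈ R.rules, ρ.2.sub).Finite :=
  R.finite.biUnion fun ρ _ => ρ.2.finite_sub

/-- The words of the elements of `sub(L ∪ E)`, computed from the words `Lw` of the elements of
`L`. -/
def valueWords (Lw : List (List F)) : List (List F) :=
  (finite_subLang R.finite_setE).toFinset.toList.map word ++ Lw.flatMap (subWords ar)

/-- The words of the elements of `D`, computed from the words `Lw` of the elements of `L`. -/
def stateWords (Lw : List (List F)) : List (List F) :=
  Lw.flatMap (subWords ar) ++ R.finite_rhsParts.toFinset.toList.flatMap fun p =>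
    (tuples (R.valueWords Lw) p.varBound).map fun ε => p.instWord ε

/-- The version of `TRS.SatStep` for words. -/
def SatStepWord (Sg : List F) (Lw : List (List F)) (Λ : List (List F × List F))
    (ab : List F × List F) : Prop :=
  ∃ ρ ∈ R.rules, ∃ ε ∈ tuples (R.valueWords Lw) ρ.1.varBound,
    RunWord Sg (R.stateWords Lw) Λ ε ρ.1 ab.2 ∧ ab.1 = ρ.2.instWord ε

/-- The condition under which a pair of words is kept or added by one round of the saturation
procedure on words. Trivial state changes and compositions are added as well, so that the reflexive
transitive closure need not be computed. -/
def NextPair (Sg : List F) (Lw : List (List F)) (Λ : List (List F × List F))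
    (ab : List F × List F) : Prop :=
  ab.1 = ab.2 ∨ ab ∈ Λ ∨ (∃ m ∈ R.stateWords Lw, (ab.1, m) ∈ Λ ∧ (m, ab.2) ∈ Λ) ∨
    R.SatStepWord Sg Lw Λ ab

open Classical in
/-- One round of the saturation procedure on words. -/
def nextPairs (Sg : List F) (Lw : List (List F)) (Λ : List (List F × List F)) :
    List (List F × List F) :=
  ((R.stateWords Lw).product (R.stateWords Lw)).filter (R.NextPair Sg Lw Λ)

/-- The result of the saturation procedure on words. The number of all pairs of states bounds the
number of rounds. -/
def saturatedPairs (Sg : List F) (Lw : List (List F)) : List (List F × List F) :=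
  (R.nextPairs Sg Lw)^[((R.stateWords Lw).product (R.stateWords Lw)).length] []

end

/-- The relation on ground terms that is given by a list of pairs of words. -/
def wordRel (Λ : List (List F × List F)) (a b : Term ar) : Prop :=
  a.IsGround ∧ b.IsGround ∧ (a.word, b.word) ∈ Λ

end Definitions

variable {F : Type} {ar : F → ℕ} {R : TRS ar} {Sg : List F} {L : List (Term ar)}
  {Λ : List (List F × List F)}

section Words

variable (hL : ∀ t ∈ L, t.IsGround)

include hL

theorem mem_flatMap_subWords {w : List F} :
    w ∈ (L.map word).flatMap (subWords ar) ↔ w ∈ word '' subLang {t | t ∈ L} := by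
  simp only [List.mem_flatMap, List.mem_map, exists_exists_and_eq_and, subLang, Set.image_iUnion₂,
    Set.mem_iUnion, exists_prop]
  exact exists_congr fun t => and_congr_right fun ht => (hL t ht).mem_subWords_word

theorem mem_valueWords {w : List F} :
    w ∈ R.valueWords (L.map word) ↔ w ∈ word '' R.values {t | t ∈ L} := by
  have hvalues : R.values {t | t ∈ L} = subLang R.setE ∪ subLang {t | t ∈ L} := by
    rw [values, Set.union_comm]
    exact Set.biUnion_union _ _ _
  rw [valueWords, List.mem_append, mem_flatMap_subWords hL, hvalues, Set.image_union]
  simp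

theorem mem_stateWords {w : List F} :
    w ∈ R.stateWords (L.map word) ↔ w ∈ word '' R.setD {t | t ∈ L} := by
  have hsetD : R.setD {t | t ∈ L} = subLang {t | t ∈ L} ∪
      ⋃ p ∈ ⋃ ρ ∈ R.rules, ρ.2.sub, p.instances (R.values {t | t ∈ L}) := by
    ext t
    simp only [mem_setD_iff, Set.mem_union, Set.mem_iUnion, exists_prop]
    aesop
  rw [stateWords, List.mem_append, mem_flatMap_subWords hL, hsetD, Set.image_union,
    Set.image_iUnion₂]
  simp only [List.mem_flatMap, mem_map_instWord_tuples fun _ => mem_valueWords hL,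
    Finset.mem_toList, Set.Finite.mem_toFinset, Set.mem_union, Set.mem_iUnion, exists_prop]

theorem word_mem_stateWords {t : Term ar} (ht : t.IsGround) :
    t.word ∈ R.stateWords (L.map word) ↔ t ∈ R.setD {t | t ∈ L} := by
  rw [mem_stateWords hL]
  exact word_injOn.mem_image_iff (fun _ => isGround_of_mem_setD hL) ht

theorem run_of_runWord {ε : List (List F)} {e : ℕ → Term ar} {l q : Term ar}
    (he : ∀ x ∈ l.vars, (e x).IsGround ∧ ε.getD x [] = (e x).word) (hq : q.IsGround)
    (h : RunWord Sg (R.stateWords (L.map word)) Λ ε l q.word) :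
    (evalTransitions {δ | δ ∈ Sg} (R.setD {t | t ∈ L}) (wordRel Λ)).Run
      (fun x => ReflTransGen (wordRel Λ) (e x)) l q := by
  induction l generalizing q with
  | var x =>
    obtain ⟨hx, hw⟩ := he x (by simp)
    exact ReflTransGen.single ⟨hx, hq, hw ▸ h⟩
  | app f ls ih =>
    obtain ⟨hf, w, hw, hhead, hwq, hi⟩ := h
    obtain ⟨t, ht, rfl⟩ := (mem_stateWords hL).1 hw
    have hg := isGround_of_mem_setD hL ht
    cases t with
    | var x => exact absurd hg (not_isGround_var x)
    | app g ts =>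
      obtain rfl : g = f := Option.some.inj hhead
      refine ⟨ts, _, ⟨hf, fun i => mem_setD_of_mem_sub ht (arg_mem_sub g ts i), ht, rfl⟩,
        fun i => ih i (fun x hx => he x (mem_vars_app.2 ⟨i, hx⟩)) (isGround_app.1 hg i) ?_,
        ReflTransGen.single ⟨hg, hq, hwq⟩⟩
      simpa [IsGround.argWords_word hg] using hi i

theorem runWord_of_run (hΛ : ∀ a b : Term ar, b ∈ R.setD {t | t ∈ L} →
      ReflTransGen (wordRel Λ) a b → (a.word, b.word) ∈ Λ)
    {ε : List (List F)} {e : ℕ → Term ar} {l q : Term ar}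
    (he : ∀ x ∈ l.vars, ε.getD x [] = (e x).word) (hq : q ∈ R.setD {t | t ∈ L})
    (h : (evalTransitions {δ | δ ∈ Sg} (R.setD {t | t ∈ L}) (wordRel Λ)).Run
      (fun x => ReflTransGen (wordRel Λ) (e x)) l q) :
    RunWord Sg (R.stateWords (L.map word)) Λ ε l q.word := by
  induction l generalizing q with
  | var x =>
    have hmem := hΛ _ _ hq h
    rwa [← he x (by simp)] at hmem
  | app f ls ih =>
    obtain ⟨ts, _, ⟨hf, hts, ht, rfl⟩, hrun, htq⟩ := h
    refine ⟨hf, _, (mem_stateWords hL).2 ⟨_, ht, rfl⟩, rfl, hΛ _ _ hq htq, fun i => ?_⟩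
    simpa [IsGround.argWords_word (isGround_of_mem_setD hL ht)] using
      ih i (fun x hx => he x (mem_vars_app.2 ⟨i, hx⟩)) (hts i) (hrun i)

theorem satStep_of_satStepWord {a b : Term ar} (ha : a.IsGround) (hb : b ∈ R.setD {t | t ∈ L})
    (h : R.SatStepWord Sg (L.map word) Λ (a.word, b.word)) :
    R.SatStep {δ | δ ∈ Sg} {t | t ∈ L} (wordRel Λ) a b := by
  obtain ⟨⟨l, r⟩, hlr, ε, hε, hrun, har⟩ := h
  obtain ⟨e, he⟩ := exists_subst_of_mem_tuples (fun _ => (mem_valueWords hL).1) hε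
  have hvalues : ∀ x ∈ l.vars, e x ∈ R.values {t | t ∈ L} := fun x hx => (he x hx).1
  have hr := rhsInstances_subset_setD (subst_mem_rhsInstances hlr hvalues)
  refine ⟨l, r, e, hlr, hvalues, hb, run_of_runWord hL (fun x hx =>
    ⟨isGround_of_mem_values hL (hvalues x hx), (he x hx).2⟩) (isGround_of_mem_setD hL hb) hrun,
    word_injOn ha (isGround_of_mem_setD hL hr) (har.trans (word_subst fun x hx => ?_).symm)⟩
  exact (he x (R.vars_subset l r hlr hx)).2

theorem satStepWord_of_satStep (hΛ : ∀ a b : Term ar, b ∈ R.setD {t | t ∈ L} →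
      ReflTransGen (wordRel Λ) a b → (a.word, b.word) ∈ Λ) {a b : Term ar}
    (h : R.SatStep {δ | δ ∈ Sg} {t | t ∈ L} (wordRel Λ) a b) :
    R.SatStepWord Sg (L.map word) Λ (a.word, b.word) := by
  obtain ⟨l, r, e, hlr, he, hb, hrun, rfl⟩ := h
  obtain ⟨ε, hε, hεe⟩ := exists_mem_tuples (fun t ht => (mem_valueWords hL).2 ⟨t, ht, rfl⟩) he
  exact ⟨(l, r), hlr, ε, hε, runWord_of_run hL hΛ hεe hb hrun,
    word_subst fun x hx => hεe x (R.vars_subset l r hlr hx)⟩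

theorem word_mem_nextPairs {a b : Term ar} (ha : a.IsGround) (hb : b.IsGround) :
    (a.word, b.word) ∈ R.nextPairs Sg (L.map word) Λ ↔
      (a ∈ R.setD {t | t ∈ L} ∧ b ∈ R.setD {t | t ∈ L}) ∧
        R.NextPair Sg (L.map word) Λ (a.word, b.word) := by
  simp only [nextPairs, List.mem_filter, List.pair_mem_product, word_mem_stateWords hL, ha, hb,
    decide_eq_true_eq]

theorem isSound_wordRel_nextPairs (h : R.IsSound {t | t ∈ L} (wordRel Λ)) :
    R.IsSound {t | t ∈ L} (wordRel (R.nextPairs Sg (L.map word) Λ)) := by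
  suffices hab : ∀ {a b}, wordRel (R.nextPairs Sg (L.map word) Λ) a b → b ∈ R.setD {t | t ∈ L} ∧
      (a = b ∨ a ∈ R.rhsInstances {t | t ∈ L}) ∧ Reduces R.rules b a from
    ⟨fun h => (hab h).1, fun h => (hab h).2.1, fun h => (hab h).2.2⟩
  rintro a b ⟨ha, hb, hab⟩
  obtain ⟨⟨-, hbD⟩, hword | hmem | ⟨w, hw, ham, hmb⟩ | hstep⟩ := (word_mem_nextPairs hL ha hb).1 hab
  · obtain rfl := word_injOn ha hb hword
    exact ⟨hbD, Or.inl rfl, ReflTransGen.refl⟩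
  · exact ⟨hbD, h.source ⟨ha, hb, hmem⟩, h.reduces ⟨ha, hb, hmem⟩⟩
  · obtain ⟨m, hm, rfl⟩ := (mem_stateWords hL).1 hw
    have hg := isGround_of_mem_setD hL hm
    have htrans : ReflTransGen (wordRel Λ) a b :=
      (ReflTransGen.single ⟨ha, hg, ham⟩).tail ⟨hg, hb, hmb⟩
    exact ⟨hbD, h.source_of_reflTransGen htrans, h.reduces_of_reflTransGen htrans⟩
  · have hstep' := satStep_of_satStepWord hL ha hbD hstep
    exact ⟨hbD, (h.satStep _).source hstep', (h.satStep _).reduces hstep'⟩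

theorem isSound_wordRel_saturatedPairs (Sg : List F) :
    R.IsSound {t | t ∈ L} (wordRel (R.saturatedPairs Sg (L.map word))) := by
  have hiter (n : ℕ) :
      R.IsSound {t | t ∈ L} (wordRel ((R.nextPairs Sg (L.map word))^[n] [])) := by
    induction n with
    | zero => constructor <;> exact fun h => absurd h.2.2 List.not_mem_nil
    | succ n ih =>
      rw [Function.iterate_succ_apply']
      exact isSound_wordRel_nextPairs hL ih
  exact hiter _

end Words

theorem nextPairs_saturatedPairs (R : TRS ar) (Sg : List F) (Lw : List (List F)) :
    R.nextPairs Sg Lw (R.saturatedPairs Sg Lw) = R.saturatedPairs Sg Lw := by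
  classical
  refine isFixedPt_iterate_nil (fun Λ => List.filter_sublist) fun Λ hΛ => ?_
  have hkeep : Λ.filter (R.NextPair Sg Lw Λ) = Λ :=
    List.filter_eq_self.2 fun ab hab => decide_eq_true (Or.inr (Or.inl hab))
  have hfilter := hΛ.filter (R.NextPair Sg Lw Λ ·)
  rwa [hkeep] at hfilter

theorem word_mem_saturatedPairs (hL : ∀ t ∈ L, t.IsGround) {a b : Term ar}
    (ha : a ∈ R.setD {t | t ∈ L}) (hb : b ∈ R.setD {t | t ∈ L})
    (h : R.NextPair Sg (L.map word) (R.saturatedPairs Sg (L.map word)) (a.word, b.word)) :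
    (a.word, b.word) ∈ R.saturatedPairs Sg (L.map word) := by
  rw [← nextPairs_saturatedPairs, word_mem_nextPairs hL (isGround_of_mem_setD hL ha)
    (isGround_of_mem_setD hL hb)]
  exact ⟨⟨ha, hb⟩, h⟩

theorem word_mem_saturatedPairs_of_reflTransGen (hL : ∀ t ∈ L, t.IsGround) {a b : Term ar}
    (hb : b ∈ R.setD {t | t ∈ L})
    (h : ReflTransGen (wordRel (R.saturatedPairs Sg (L.map word))) a b) :
    (a.word, b.word) ∈ R.saturatedPairs Sg (L.map word) := by
  have hsupp {a b} := ((isSound_wordRel_saturatedPairs (R := R) hL Sg).supportedOn ∅).eps a b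
  induction h using ReflTransGen.head_induction_on with
  | refl => exact word_mem_saturatedPairs hL hb hb (Or.inl rfl)
  | head hac _ ih =>
    obtain ⟨ha, hc⟩ := hsupp hac
    exact word_mem_saturatedPairs hL ha hb
      (Or.inr (Or.inr (Or.inl ⟨_, (mem_stateWords hL).2 ⟨_, hc, rfl⟩, hac.2.2, ih⟩)))

theorem isSaturated_wordRel (hL : ∀ t ∈ L, t.IsGround) (Sg : List F) :
    R.IsSaturated {δ | δ ∈ Sg} {t | t ∈ L} (wordRel (R.saturatedPairs Sg (L.map word))) where
  toIsSound := isSound_wordRel_saturatedPairs hL Sg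
  closed {a b} h := by
    have hs := (isSound_wordRel_saturatedPairs (R := R) hL Sg).satStep {δ | δ ∈ Sg}
    obtain ⟨ha, hb⟩ := (hs.supportedOn ∅).eps a b h
    refine ReflTransGen.single ⟨isGround_of_mem_setD hL ha, isGround_of_mem_setD hL hb,
      word_mem_saturatedPairs hL ha hb (Or.inr (Or.inr (Or.inr ?_)))⟩
    exact satStepWord_of_satStep hL
      (fun _ _ hb => word_mem_saturatedPairs_of_reflTransGen hL hb) h

end TRS

namespace TRS

open Primrec Term

section Computability

variable {F : Type} [Primcodable F] {ar : F → ℕ}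

theorem primrecPred_runWord (har : Primrec ar) (l : Term ar) :
    PrimrecPred fun z : ((List F × List (List F)) × List (List F × List F)) ×
      List (List F) × List F => RunWord z.1.1.1 z.1.1.2 z.1.2 z.2.1 l z.2.2 := by
  induction l with
  | var x =>
    exact primrecRel_mem_list.comp (Primrec.pair ((list_getD []).comp (fst.comp snd)
      (Primrec.const x)) (snd.comp snd)) (snd.comp fst)
  | app f ls ih =>
    have hword : PrimrecRel fun (w : List F) (z : ((List F × List (List F)) ×
        List (List F × List F)) × List (List F) × List F) =>
        w.head? = some f ∧ (w, z.2.2) ∈ z.1.2 ∧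
          ∀ i, RunWord z.1.1.1 z.1.1.2 z.1.2 z.2.1 (ls i) ((argWords ar w).getD i []) := by
      refine (Primrec.eq.comp (list_head?.comp fst) (Primrec.const (some f))).and
        ((primrecRel_mem_list.comp (Primrec.pair fst (snd.comp (snd.comp snd)))
          (snd.comp (fst.comp snd))).and (primrecPred_forall_fin fun i => ?_))
      exact (ih i).comp (Primrec.pair (fst.comp snd) (Primrec.pair (fst.comp (snd.comp snd))
        ((list_getD []).comp ((primrec_argWords har).comp fst) (Primrec.const (i : ℕ)))))
    exact (primrecRel_mem_list.comp (Primrec.const f) (fst.comp (fst.comp fst))).and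
      (hword.exists_mem_list.comp (snd.comp (fst.comp fst)) Primrec.id)

variable (R : TRS ar)

theorem primrec_valueWords (har : Primrec ar) : Primrec R.valueWords :=
  list_append.comp (Primrec.const _)
    (list_flatMap Primrec.id ((primrec_subWords har).comp snd))

theorem primrec_stateWords (har : Primrec ar) : Primrec R.stateWords :=
  list_append.comp (list_flatMap Primrec.id ((primrec_subWords har).comp snd))
    (primrec_flatMap_const _ fun p =>
      list_map ((primrec_tuples p.varBound).comp (R.primrec_valueWords har))
        ((primrec_instWord p).comp snd))

theorem primrecRel_satStepWord (har : Primrec ar) :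
    PrimrecRel fun (ab : List F × List F)
      (y : (List F × List (List F)) × List (List F × List F)) =>
        R.SatStepWord y.1.1 y.1.2 y.2 ab := by
  have hrule (ρ : Term ar × Term ar) : PrimrecPred fun z : (List F × List F) ×
      (List F × List (List F)) × List (List F × List F) =>
      ∃ ε ∈ tuples (R.valueWords z.2.1.2) ρ.1.varBound,
        RunWord z.2.1.1 (R.stateWords z.2.1.2) z.2.2 ε ρ.1 z.1.2 ∧ z.1.1 = ρ.2.instWord ε := by
    have htuple : PrimrecRel fun (ε : List (List F)) (z : (List F × List F) ×
        (List F × List (List F)) × List (List F × List F)) =>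
        RunWord z.2.1.1 (R.stateWords z.2.1.2) z.2.2 ε ρ.1 z.1.2 ∧ z.1.1 = ρ.2.instWord ε :=
      ((primrecPred_runWord har ρ.1).comp (Primrec.pair (Primrec.pair
        (Primrec.pair (fst.comp (fst.comp (snd.comp snd)))
          ((R.primrec_stateWords har).comp (snd.comp (fst.comp (snd.comp snd)))))
        (snd.comp (snd.comp snd))) (Primrec.pair fst (snd.comp (fst.comp snd))))).and
      (Primrec.eq.comp (fst.comp (fst.comp snd)) ((primrec_instWord ρ.2).comp fst))
    exact htuple.exists_mem_list.comp ((primrec_tuples ρ.1.varBound).comp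
      ((R.primrec_valueWords har).comp (snd.comp (fst.comp snd)))) Primrec.id
  exact (primrecPred_exists_mem_const R.finite.toFinset.toList hrule).of_eq fun z => by
    simp only [Finset.mem_toList, Set.Finite.mem_toFinset, SatStepWord]

theorem primrecRel_nextPair (har : Primrec ar) :
    PrimrecRel fun (ab : List F × List F)
      (y : (List F × List (List F)) × List (List F × List F)) =>
        R.NextPair y.1.1 y.1.2 y.2 ab := by
  have hcomp : PrimrecRel fun (m : List F) (z : (List F × List F) ×
      (List F × List (List F)) × List (List F × List F)) =>
      (z.1.1, m) ∈ z.2.2 ∧ (m, z.1.2) ∈ z.2.2 :=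
    (primrecRel_mem_list.comp (Primrec.pair (fst.comp (fst.comp snd)) fst)
      (snd.comp (snd.comp snd))).and
    (primrecRel_mem_list.comp (Primrec.pair fst (snd.comp (fst.comp snd)))
      (snd.comp (snd.comp snd)))
  exact (Primrec.eq.comp (fst.comp fst) (snd.comp fst)).or
    ((primrecRel_mem_list.comp fst (snd.comp snd)).or
      ((hcomp.exists_mem_list.comp ((R.primrec_stateWords har).comp
        (snd.comp (fst.comp snd))) Primrec.id).or (R.primrecRel_satStepWord har)))

theorem primrec_saturatedPairs (har : Primrec ar) :
    Primrec fun z : List F × List (List F) => R.saturatedPairs z.1 z.2 := by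
  classical
  have hpairs : Primrec fun z : List F × List (List F) =>
      (R.stateWords z.2).product (R.stateWords z.2) :=
    list_flatMap ((R.primrec_stateWords har).comp snd)
      (list_map ((R.primrec_stateWords har).comp (snd.comp fst)) (Primrec.pair (snd.comp fst) snd))
  have hnext : Primrec₂ fun (z : List F × List (List F)) (Λ : List (List F × List F)) =>
      R.nextPairs z.1 z.2 Λ :=
    ((PrimrecRel.listFilter (R.primrecRel_nextPair har)).comp (hpairs.comp fst) Primrec.id).of_eq
      fun y => by simp only [nextPairs, id]
  exact nat_iterate (list_length.comp hpairs) (Primrec.const []) hnext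

end Computability

section Algorithm

variable (R : TRS rank)

/-- The algorithm of `TRS.IsEPRF`. The states of the automaton for the descendants are encoded by
the codes of their words. -/
noncomputable def descendantsCode (z : List RSym × List (List RSym)) : AutomatonCode :=
  ((R.stateWords z.2).map Encodable.encode, z.2.map Encodable.encode,
    ((R.stateWords z.2).filter fun w => w.headI ∈ z.1).map fun w =>
      (w.headI, (argWords rank w).map Encodable.encode, Encodable.encode w),
    (R.saturatedPairs z.1 z.2).map fun ab => (Encodable.encode ab.1, Encodable.encode ab.2))

theorem computable_descendantsCode : Computable R.descendantsCode := by
  have hrank : Primrec rank := Primrec.snd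
  have hstates : Primrec fun z : List RSym × List (List RSym) => R.stateWords z.2 :=
    (R.primrec_stateWords hrank).comp snd
  have hroot : PrimrecRel fun (w : List RSym) (z : List RSym × List (List RSym)) => w.headI ∈ z.1 :=
    primrecRel_mem_list.comp (list_headI.comp fst) (fst.comp snd)
  have hfilter : Primrec fun z : List RSym × List (List RSym) =>
      (R.stateWords z.2).filter fun w => w.headI ∈ z.1 :=
    (PrimrecRel.listFilter hroot).comp hstates Primrec.id
  have hencode : Primrec (List.map (Encodable.encode : List RSym → ℕ)) :=
    list_map Primrec.id (Primrec.encode.comp snd)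
  have hrule : Primrec₂ fun (_ : List RSym × List (List RSym)) (w : List RSym) =>
      (w.headI, (argWords rank w).map Encodable.encode, Encodable.encode w) :=
    Primrec.pair (list_headI.comp snd) (Primrec.pair
      (hencode.comp ((primrec_argWords hrank).comp snd)) (Primrec.encode.comp snd))
  have hpair : Primrec₂ fun (_ : List RSym × List (List RSym)) (ab : List RSym × List RSym) =>
      (Encodable.encode ab.1, Encodable.encode ab.2) :=
    Primrec.pair (Primrec.encode.comp (fst.comp snd)) (Primrec.encode.comp (snd.comp snd))
  exact ((hencode.comp hstates).pair ((hencode.comp snd).pair ((list_map hfilter hrule).pair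
    (list_map (R.primrec_saturatedPairs hrank) hpair)))).to_comp

end Algorithm

end TRS

namespace TRS

open Term Relation Transitions

variable {R : TRS rank} {Sg : List RSym} {L : List (Term rank)}

/-- The state of the computed automaton that corresponds to a term. -/
def stateCode (t : Term rank) : ℕ := Encodable.encode t.word

theorem stateCode_injOn : Set.InjOn stateCode {t | t.IsGround} :=
  Encodable.encode_injective.comp_injOn word_injOn

/-- The transitions that correspond to the result of the saturation procedure on words. -/
def saturatedTransitions (R : TRS rank) (Sg : List RSym) (L : List (Term rank)) :
    Transitions rank (Term rank) :=
  evalTransitions {δ | δ ∈ Sg} (R.setD {t | t ∈ L}) (wordRel (R.saturatedPairs Sg (L.map word)))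

section Code

variable (hL : ∀ t ∈ L, t.IsGround)

include hL

theorem mem_states_descendantsCode {n : ℕ} :
    n ∈ (R.descendantsCode (Sg, L.map word)).1 ↔ n ∈ stateCode '' R.setD {t | t ∈ L} := by
  simp only [descendantsCode, List.mem_map, mem_stateWords hL, Set.mem_image,
    exists_exists_and_eq_and, stateCode]

theorem mem_symbolRules_descendantsCode {f : RSym} {as : Fin (rank f) → ℕ} {n : ℕ} :
    (f, List.ofFn as, n) ∈ (R.descendantsCode (Sg, L.map word)).2.2.1 ↔
      ((R.saturatedTransitions Sg L).map stateCode).move f as n := by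
  have hargs {g : RSym} {ts : Fin (rank g) → Term rank} (ht : app g ts ∈ R.setD {t | t ∈ L}) :
      (argWords rank (app g ts).word).map Encodable.encode = List.ofFn (stateCode ∘ ts) := by
    rw [IsGround.argWords_word (isGround_of_mem_setD hL ht), List.map_ofFn]
    rfl
  simp only [descendantsCode, List.mem_map, List.mem_filter, decide_eq_true_eq, mem_stateWords hL]
  constructor
  · rintro ⟨_, ⟨⟨t, ht, rfl⟩, hhead⟩, h⟩
    cases t with
    | var x => exact absurd (isGround_of_mem_setD hL ht) (not_isGround_var x)
    | app g ts =>
      rw [hargs ht] at h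
      obtain rfl : g = f := congrArg Prod.fst h
      have has := List.ofFn_injective (congrArg (fun y => y.2.1) h)
      exact ⟨ts, _, ⟨hhead, fun i => mem_setD_of_mem_sub ht (arg_mem_sub g ts i), ht, rfl⟩,
        has.symm, (congrArg (fun y => y.2.2) h).symm⟩
  · rintro ⟨ts, _, ⟨hf, -, ht, rfl⟩, rfl, rfl⟩
    exact ⟨_, ⟨⟨_, ht, rfl⟩, hf⟩, hargs ht ▸ rfl⟩

theorem mem_lambdaRules_descendantsCode {m n : ℕ} :
    (m, n) ∈ (R.descendantsCode (Sg, L.map word)).2.2.2 ↔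
      ((R.saturatedTransitions Sg L).map stateCode).eps m n := by
  simp only [descendantsCode, List.mem_map]
  constructor
  · rintro ⟨⟨v, w⟩, hvw, h⟩
    have hmem := hvw
    rw [← nextPairs_saturatedPairs] at hmem
    obtain ⟨hv, hw⟩ := List.pair_mem_product.1 (List.mem_of_mem_filter hmem)
    obtain ⟨a, ha, rfl⟩ := (mem_stateWords hL).1 hv
    obtain ⟨b, hb, rfl⟩ := (mem_stateWords hL).1 hw
    exact ⟨a, b, ⟨isGround_of_mem_setD hL ha, isGround_of_mem_setD hL hb, hvw⟩,
      (congrArg Prod.fst h).symm, (congrArg Prod.snd h).symm⟩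
  · rintro ⟨a, b, hab, rfl, rfl⟩
    exact ⟨_, hab.2.2, rfl⟩

theorem toAutomaton_descendantsCode :
    (R.descendantsCode (Sg, L.map word)).toAutomaton =
      ⟨stateCode '' R.setD {t | t ∈ L}, ((R.saturatedTransitions Sg L).map stateCode).rules,
        stateCode '' {t | t ∈ L}⟩ := by
  have hfinal {n : ℕ} : n ∈ (R.descendantsCode (Sg, L.map word)).2.1 ↔
      n ∈ stateCode '' {t | t ∈ L} := by
    simp [descendantsCode, stateCode]
  simp only [AutomatonCode.toAutomaton, mem_states_descendantsCode hL,
    mem_symbolRules_descendantsCode hL, mem_lambdaRules_descendantsCode hL, hfinal]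
  rfl

theorem supportedOn_saturatedTransitions (R : TRS rank) (Sg : List RSym) :
    (R.saturatedTransitions Sg L).SupportedOn {δ | δ ∈ Sg} (R.setD {t | t ∈ L}) :=
  (isSound_wordRel_saturatedPairs hL Sg).supportedOn _

theorem descendantsCode_isBTA :
    (R.descendantsCode (Sg, L.map word)).toAutomaton.IsBTA {δ | δ ∈ Sg} := by
  rw [toAutomaton_descendantsCode hL]
  exact (supportedOn_saturatedTransitions hL R Sg).map.isBTA (List.finite_toSet Sg)
    ((R.finite_setD (List.finite_toSet L)).image _) (Set.image_mono subset_setD)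

end Code

theorem descendantsCode_language (hlin : R.LeftLinear) (hgsm : R.IsGSM)
    (hSg : R.sign ⊆ {δ | δ ∈ Sg}) (hL : ∀ t ∈ L, t ∈ groundTerms rank {δ | δ ∈ Sg}) :
    (R.descendantsCode (Sg, L.map word)).toAutomaton.language {δ | δ ∈ Sg} =
      R.descendants {t | t ∈ L} := by
  have hground : ∀ t ∈ L, t.IsGround := fun t ht => (hL t ht).1
  have hinj : (R.setD {t | t ∈ L}).InjOn stateCode :=
    stateCode_injOn.mono fun _ => isGround_of_mem_setD hground
  rw [toAutomaton_descendantsCode hground]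
  refine TreeAutomaton.language_eq_descendants hSg hL rfl fun p hp t ht => ?_
  have hpD : p ∈ R.setD {t | t ∈ L} := subset_setD hp
  rw [reduces_lift_iff_run, run_map_iff (supportedOn_saturatedTransitions hground R Sg) hinj hpD]
  exact (isSaturated_wordRel hground Sg).run_iff_reduces hSg hlin hgsm (hL p hp) hpD ht

theorem isEPRF (hlin : R.LeftLinear) (hgsm : R.IsGSM) : R.IsEPRF :=
  ⟨R.descendantsCode, R.computable_descendantsCode, fun _ _ hSg hL =>
    ⟨descendantsCode_isBTA fun t ht => (hL t ht).1, descendantsCode_language hlin hgsm hSg hL⟩⟩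

end TRS

theorem mainTheorem1 (R : TRS rank) (hlin : R.LeftLinear) (hgsm : R.IsGSM) :
    R.IsEPRF ∧
    R.setE.Finite ∧
    ∀ (Sg : Set RSym) (L : Set (Term rank)), Sg.Finite → R.sign ⊆ Sg → L.Finite →
      L ⊆ groundTerms rank Sg →
        (R.setD L).Finite ∧
        ∃ M : ℕ, IsLeast {i | R.satRules Sg L i = R.satRules Sg L (i + 1)} M ∧
          (R.satAutomaton Sg L M).IsBTA Sg ∧
          (R.satAutomaton Sg L M).language Sg = R.descendants L := by
  classical
  refine ⟨TRS.isEPRF hlin hgsm, R.finite_setE, fun Sg L hSg hsign hL hLg => ⟨R.finite_setD hL, ?_⟩⟩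
  have hex := R.exists_satRules_eq hSg hL
  exact ⟨Nat.find hex, ⟨Nat.find_spec hex, fun i hi => Nat.find_min' hex hi⟩,
    R.satAutomaton_isBTA hSg hL _, R.satAutomaton_language hlin hgsm hsign hLg (Nat.find_spec hex)⟩
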